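/- Let $p$ be a prime and let $F\in\mathbb{Q}_p[X]$ be a polynomial of degree $6$ with roots $\theta_1,\dots,\theta_6\in\overline{\mathbb{Q}}_p$ (listed with multiplicity). Assume that the roots lie in the complement of the $E_6$ hyperplane arrangement, i.e. that $\theta_i-\theta_j\neq 0$ for $i<j$, $\theta_i+\theta_j+\theta_k\neq 0$ for $i<j<k$, and $\theta_1+\cdots+\theta_6\neq 0$. Let $V$ be the space of ternary cubic forms over $\overline{\mathbb{Q}}_p$ vanishing at the six points $(1:\theta_i:\theta_i^3)\in\mathbb{P}^2$. Then $V$ has a basis $f_0,\dots,f_3$ consisting of four forms with coefficients in $\mathbb{Q}_p$. For every such basis, let $\mathrm{Bl}\subset\mathbb{P}^2\times\mathbb{P}^3$ be the Zariski closure of the graph of the rational map $(f_0:f_1:f_2:f_3)\colon\mathbb{P}^2\dashrightarrow\mathbb{P}^3$ over $\overline{\mathbb{Q}}_p$ (this is the blow-up of $\mathbb{P}^2$ at the six points), and let $\mathcal{S}(F)\subset\mathbb{P}^3$ be the image of $\mathrm{Bl}$ under the second projection. Then this projection is injective on $\mathrm{Bl}$; the image $\mathcal{S}(F)$ is a smooth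 cubic surface defined over $\mathbb{Q}_p$, i.e. the zero locus of a cubic form with coefficients in $\mathbb{Q}_p$ that has no singular point over $\overline{\mathbb{Q}}_p$; and $\mathcal{S}(F)$ contains exactly $$2\ell+q+\binom{\ell}{2}$$ lines of $\mathbb{P}^3$ that are defined over $\mathbb{Q}_p$, where $\ell$ and $q$ are the numbers of linear and quadratic irreducible factors of $F$ in $\mathbb{Q}_p[X]$, respectively. -/

import Mathlib

open Polynomial
open scoped LinearAlgebra.Projectivization

/-- The six parameters `θ i` lie in the complement of the hyperplane arrangement of type `E6`. -/
structure AvoidsE6 {L : Type*} [Field L] (θ : Fin 6 → L) : Prop where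
  sub_ne_zero : ∀ i j, i < j → θ i - θ j ≠ 0
  add_add_ne_zero : ∀ i j k, i < j → j < k → θ i + θ j + θ k ≠ 0
  sum_ne_zero : ∑ i, θ i ≠ 0

/-- Homogeneous coordinates of the point `(1 : t : t ^ 3)` of the cuspidal cubic curve. -/
def cuspPoint {L : Type*} [Field L] (t : L) : Fin 3 → L := ![1, t, t ^ 3]

/-- The space of ternary cubic forms over `L` that vanish at the six points
`(1 : θ i : θ i ^ 3)`. -/
noncomputable def cubicsThrough {L : Type*} [Field L] (θ : Fin 6 → L) :
    Submodule L (MvPolynomial (Fin 3) L) :=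
  MvPolynomial.homogeneousSubmodule (Fin 3) L 3 ⊓
    ⨅ i, LinearMap.ker (MvPolynomial.aeval (R := L) (cuspPoint (θ i))).toLinearMap

/-- The forms `f j`, with their coefficients regarded as elements of the extension field `L`. -/
noncomputable def extendScalars {K : Type*} (L : Type*) [Field K] [Field L] [Algebra K L]
    (f : Fin 4 → MvPolynomial (Fin 3) K) (j : Fin 4) : MvPolynomial (Fin 3) L :=
  MvPolynomial.map (algebraMap K L) (f j)

/-- `f` consists of four cubic forms with coefficients in the subfield `K` which form an `L`-basis
of the space of all cubic forms over `L` through the six points. -/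
structure IsRationalBasis {K L : Type*} [Field K] [Field L] [Algebra K L] (θ : Fin 6 → L)
    (f : Fin 4 → MvPolynomial (Fin 3) K) : Prop where
  linearIndependent : LinearIndependent L (extendScalars L f)
  span_eq : Submodule.span L (Set.range (extendScalars L f)) = cubicsThrough θ

/-- The polynomial `h`, in two groups of variables, vanishes at the point `z` of a product of two
projective spaces, i.e. at all pairs of coordinate vectors of `z`. Over an infinite field this
means that every bihomogeneous component of `h` vanishes at `z`. -/
def VanishesAt {L : Type*} [Field L] {m n : ℕ} (h : MvPolynomial (Fin m ⊕ Fin n) L)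
    (z : ℙ L (Fin m → L) × ℙ L (Fin n → L)) : Prop :=
  ∀ (u : Fin m → L) (hu : u ≠ 0) (v : Fin n → L) (hv : v ≠ 0),
    (Projectivization.mk L u hu, Projectivization.mk L v hv) = z →
      MvPolynomial.eval (Sum.elim u v) h = 0

/-- The Zariski closure of a subset of a product of two projective spaces over an infinite
field. -/
def biprojectiveClosure {L : Type*} [Field L] {m n : ℕ}
    (A : Set (ℙ L (Fin m → L) × ℙ L (Fin n → L))) :
    Set (ℙ L (Fin m → L) × ℙ L (Fin n → L)) :=
  {z | ∀ h : MvPolynomial (Fin m ⊕ Fin n) L, (∀ w ∈ A, VanishesAt h w) → VanishesAt h z}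

/-- The graph of the rational map `x ↦ (f 0 x : f 1 x : f 2 x : f 3 x)` from the projective plane
to projective three-space, over the open set where the `f j` do not all vanish. -/
def rationalMapGraph {L : Type*} [Field L] (f : Fin 4 → MvPolynomial (Fin 3) L) :
    Set (ℙ L (Fin 3 → L) × ℙ L (Fin 4 → L)) :=
  {z | ∃ (u : Fin 3 → L) (hu : u ≠ 0) (hv : (fun j => MvPolynomial.eval u (f j)) ≠ 0),
    z = (Projectivization.mk L u hu, Projectivization.mk L _ hv)}

/-- The blow-up of the projective plane along the ideal generated by the cubic forms `f j`: the
closure of the graph of the rational map they define. If the `f j` are a basis of the cubic forms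
through six points in general position, they generate the homogeneous ideal of the six points, and
this is the blow-up of the plane at the six points. -/
def blowUp {L : Type*} [Field L] (f : Fin 4 → MvPolynomial (Fin 3) L) :
    Set (ℙ L (Fin 3 → L) × ℙ L (Fin 4 → L)) :=
  biprojectiveClosure (rationalMapGraph f)

/-- The surface in projective three-space which is the image of the blow-up under the morphism
given by the cubic forms `f j`. -/
def blowUpSurface {L : Type*} [Field L] (f : Fin 4 → MvPolynomial (Fin 3) L) :
    Set (ℙ L (Fin 4 → L)) :=
  Prod.snd '' blowUp f

/-- `S` is a smooth cubic surface over `L` defined over `K`: the zero locus of a cubic form with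
coefficients in `K` that has no singular zero over `L`. (Here `L` is meant to be algebraically
closed.) -/
def IsSmoothCubicSurfaceOver (K : Type*) {L : Type*} [Field K] [Field L] [Algebra K L]
    (S : Set (ℙ L (Fin 4 → L))) : Prop :=
  ∃ g : MvPolynomial (Fin 4) K, g.IsHomogeneous 3 ∧
    (∀ (v : Fin 4 → L) (hv : v ≠ 0),
      Projectivization.mk L v hv ∈ S ↔ MvPolynomial.aeval v g = 0) ∧
    ∀ v : Fin 4 → L, v ≠ 0 → MvPolynomial.aeval v g = 0 →
      ∃ k, MvPolynomial.aeval v (MvPolynomial.pderiv k g) ≠ 0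

/-- The `K`-rational lines on `S`: the lines of projective three-space over `L`, given as
two-dimensional linear subspaces of `L ^ 4`, that are contained in `S` and are defined over `K`,
i.e. are spanned by a linear subspace of `K ^ 4`. -/
def rationalLines (K : Type*) {L : Type*} [Field K] [Field L] [Algebra K L]
    (S : Set (ℙ L (Fin 4 → L))) : Set (Submodule L (Fin 4 → L)) :=
  {W | Module.finrank L W = 2 ∧
    (∀ (v : Fin 4 → L) (hv : v ≠ 0), v ∈ W → Projectivization.mk L v hv ∈ S) ∧
    ∃ W₀ : Submodule K (Fin 4 → K),
      W = Submodule.span L ((fun w j => algebraMap K L (w j)) '' (W₀ : Set (Fin 4 → K)))}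

open Classical in
/-- The number of irreducible factors of degree `d` of a nonzero polynomial over a field, counted
with multiplicity. -/
noncomputable def numIrreducibleFactors {K : Type*} [Field K] (F : K[X]) (d : ℕ) :
    ℕ :=
  ((UniqueFactorizationMonoid.normalizedFactors F).filter fun P => P.natDegree = d).card

/-!
With `e` the signed coefficients of the sextic, explicit cubics through the six points have three
syzygies that are linear in the point `u` of the plane and in the image point `v`. Written as
`syzMatrix e v *ᵥ u = 0`, they cut out the blow-up, and the image is the determinantal cubic surface
`det (syzMatrix e v) = 0`. General position of the roots forces `syzMatrix e v` to have rank two on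
the surface, so `v` determines `u`, and makes the surface smooth.

A line on the surface is a singular pencil of `3 × 3` matrices of rank two. By Kronecker's
classification it has a constant kernel vector, a linear polynomial kernel vector, or a constant
left kernel vector: these are the exceptional lines over the six points, the images of the chords
through two points, and the images of the conics through five points. They meet exactly one, two and
five of the six exceptional lines, and are determined by this set of exceptional lines.

A field automorphism permutes the exceptional lines as it permutes the roots, so by Galois descent a
line is rational if and only if the set of roots belonging to it is Galois stable. Stable singletons
and their complements correspond to linear factors, stable pairs to quadratic factors and to pairs
of linear factors.
-/

open scoped Matrix

section LinearAlgebra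

variable {L : Type*} [Field L]

section Minors

variable {n : ℕ} {N : Matrix (Fin n) (Fin (n + 1)) L} {v : Fin (n + 1) → L}

/-- The signed maximal minors of an `n × (n + 1)` matrix. -/
def maximalMinors {R : Type*} [CommRing R] (N : Matrix (Fin n) (Fin (n + 1)) R)
    (j : Fin (n + 1)) : R :=
  (-1) ^ (j : ℕ) * (N.submatrix id j.succAbove).det

theorem det_cons_eq_dotProduct_maximalMinors {R : Type*} [CommRing R] (x : Fin (n + 1) → R)
    (N : Matrix (Fin n) (Fin (n + 1)) R) :
    (Matrix.of (Fin.cons x N : Fin (n + 1) → Fin (n + 1) → R)).det = x ⬝ᵥ maximalMinors N := by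
  rw [Matrix.det_succ_row_zero, dotProduct]
  refine Finset.sum_congr rfl fun j _ => ?_
  rw [maximalMinors, mul_left_comm, ← mul_assoc]
  rfl

/-- Cramer's rule: extend `N` by a row that also annihilates `v`. -/
theorem maximalMinors_mul_comm_of_mulVec_eq_zero (h : N *ᵥ v = 0) (j k : Fin (n + 1)) :
    maximalMinors N j * v k = maximalMinors N k * v j := by
  rcases eq_or_ne v 0 with rfl | hv
  · simp
  let x : Fin (n + 1) → L := Pi.single j (v k) - Pi.single k (v j)
  have hker : Matrix.of (Fin.cons x N : Fin (n + 1) → Fin (n + 1) → L) *ᵥ v = 0 := by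
    funext i
    refine Fin.cases ?_ (fun i => congrFun h i) i
    change x ⬝ᵥ v = 0
    rw [sub_dotProduct, single_dotProduct, single_dotProduct, mul_comm, sub_self]
  have hdet := Matrix.exists_mulVec_eq_zero_iff.mp ⟨v, hv, hker⟩
  rw [det_cons_eq_dotProduct_maximalMinors, sub_dotProduct, single_dotProduct,
    single_dotProduct] at hdet
  linear_combination hdet

theorem exists_eq_smul_maximalMinors (hN : maximalMinors N ≠ 0) (h : N *ᵥ v = 0) :
    ∃ c : L, v = c • maximalMinors N := by
  obtain ⟨k, hk : maximalMinors N k ≠ 0⟩ := Function.ne_iff.mp hN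
  refine ⟨v k / maximalMinors N k, funext fun j => ?_⟩
  rw [Pi.smul_apply, smul_eq_mul, div_mul_eq_mul_div, eq_div_iff hk, mul_comm (v j), mul_comm (v k)]
  exact maximalMinors_mul_comm_of_mulVec_eq_zero h k j

theorem maximalMinors_eq_zero_of_vecMul_eq_zero {w : Fin n → L} (hw : w ≠ 0)
    (h : w ᵥ* N = 0) : maximalMinors N = 0 := by
  funext j
  have hdet : (N.submatrix id j.succAbove).det = 0 :=
    Matrix.exists_vecMul_eq_zero_iff.mp ⟨w, hw, funext fun k => congrFun h (j.succAbove k)⟩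
  rw [maximalMinors, hdet, mul_zero, Pi.zero_apply]

end Minors

section Adjugate

variable {n : Type*} [Fintype n] [DecidableEq n] {A : Matrix n n L} {u : n → L}

theorem adjugate_eq_zero_of_linearIndependent {u' : n → L} (hli : LinearIndependent L ![u, u'])
    (hu : A *ᵥ u = 0) (hu' : A *ᵥ u' = 0) : A.adjugate = 0 := by
  rw [LinearIndependent.pair_iff] at hli
  ext i j
  obtain ⟨x, hx, hAx, hxi⟩ : ∃ x ≠ 0, A *ᵥ x = 0 ∧ x i = 0 := by
    by_cases hi : u i = 0
    · exact ⟨u, fun h0 => one_ne_zero (hli 1 0 (by simp [h0])).1, hu, hi⟩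
    · refine ⟨u' i • u - u i • u', fun h0 => hi ?_, ?_, ?_⟩
      · exact neg_eq_zero.mp (hli (u' i) (-u i) (by rwa [neg_smul, ← sub_eq_add_neg])).2
      · rw [Matrix.mulVec_sub, Matrix.mulVec_smul, Matrix.mulVec_smul, hu, hu', smul_zero,
          smul_zero, sub_zero]
      · simp only [Pi.sub_apply, Pi.smul_apply, smul_eq_mul, mul_comm, sub_self]
  rw [Matrix.adjugate_apply]
  refine Matrix.exists_mulVec_eq_zero_iff.mp ⟨x, hx, funext fun k => ?_⟩
  rcases eq_or_ne k j with rfl | hk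
  · rw [Matrix.mulVec, Matrix.updateRow_self, single_dotProduct, hxi, mul_zero, Pi.zero_apply]
  · rw [Matrix.mulVec, Matrix.updateRow_ne hk]
    exact congrFun hAx k

theorem mulVec_adjugate_col_eq_zero (hdet : A.det = 0) (j : n) :
    (A *ᵥ fun i => A.adjugate i j) = 0 := by
  funext i
  have := congrFun (congrFun (Matrix.mul_adjugate A) i) j
  rwa [hdet, zero_smul] at this

theorem exists_adjugate_eq_vecMulVec (hdet : A.det = 0) (hu : u ≠ 0)
    (hker : ∀ x, A *ᵥ x = 0 → ∃ c : L, x = c • u) :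
    ∃ w, A.adjugate = Matrix.vecMulVec u w ∧ w ᵥ* A = 0 := by
  choose w hw using fun j => hker _ (mulVec_adjugate_col_eq_zero hdet j)
  have hadj : A.adjugate = Matrix.vecMulVec u w := by
    ext i j
    rw [Matrix.vecMulVec_apply, mul_comm]
    exact congrFun (hw j) i
  refine ⟨w, hadj, ?_⟩
  have h0 := Matrix.adjugate_mul A
  rw [hadj, hdet, zero_smul, Matrix.vecMulVec_mul] at h0
  obtain ⟨i, hi : u i ≠ 0⟩ := Function.ne_iff.mp hu
  funext j
  exact (mul_eq_zero.mp (congrFun (congrFun h0 i) j)).resolve_left hi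

end Adjugate

theorem trace_vecMulVec_mul {n : Type*} [Fintype n] (u w : n → L) (B : Matrix n n L) :
    (Matrix.vecMulVec u w * B).trace = w ⬝ᵥ (B *ᵥ u) := by
  rw [Matrix.vecMulVec_mul, Matrix.trace_vecMulVec, dotProduct_comm, Matrix.dotProduct_mulVec]

end LinearAlgebra

section Pencil

variable {L : Type*} [Field L]

theorem eq_zero_of_forall_sum_pow_mul_eq_zero [Infinite L] {n : ℕ} {c : Fin n → L}
    (h : ∀ s : L, ∑ i : Fin n, s ^ (i : ℕ) * c i = 0) : c = 0 := by
  have hP : (∑ i : Fin n, monomial (i : ℕ) (c i)) = 0 := by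
    refine Polynomial.funext fun s => ?_
    simp only [eval_finsetSum, eval_monomial, eval_zero, mul_comm (c _), h]
  funext i
  have := congrArg (fun P => P.coeff (i : ℕ)) hP
  simpa [coeff_monomial, Fin.val_inj] using this

theorem adjugate_add_smul_fin_three {R : Type*} [CommRing R] (A B : Matrix (Fin 3) (Fin 3) R)
    (s : R) : (A + s • B).adjugate =
      A.adjugate + s • ((A + B).adjugate - A.adjugate - B.adjugate) + s ^ 2 • B.adjugate := by
  ext i j
  fin_cases i <;> fin_cases j <;> simp [Matrix.adjugate_fin_three] <;> ring

/-- The coefficients of the adjugate of a singular pencil form a polynomial kernel vector. -/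
theorem exists_quadratic_kernel_of_singular_pencil [Infinite L] {A B : Matrix (Fin 3) (Fin 3) L}
    (hdet : ∀ s : L, (A + s • B).det = 0) (hB : B.adjugate ≠ 0) :
    ∃ a b c, c ≠ 0 ∧ A *ᵥ a = 0 ∧ A *ᵥ b + B *ᵥ a = 0 ∧ A *ᵥ c + B *ᵥ b = 0 ∧ B *ᵥ c = 0 := by
  set Q := (A + B).adjugate - A.adjugate - B.adjugate with hQ
  have hcoeff (i j : Fin 3) : ![(A * A.adjugate) i j, (A * Q + B * A.adjugate) i j,
      (A * B.adjugate + B * Q) i j, (B * B.adjugate) i j] = 0 := by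
    refine eq_zero_of_forall_sum_pow_mul_eq_zero fun s => ?_
    have h0 : (A + s • B) * (A + s • B).adjugate = 0 := by
      rw [Matrix.mul_adjugate, hdet, zero_smul]
    rw [adjugate_add_smul_fin_three, ← hQ] at h0
    have := congrFun (congrFun h0 i) j
    simp only [add_mul, mul_add, Matrix.smul_mul, Matrix.mul_smul, Matrix.add_apply,
      Matrix.smul_apply, smul_eq_mul, Matrix.zero_apply] at this
    rw [Fin.sum_univ_four]
    change s ^ 0 * (A * A.adjugate) i j + s ^ 1 * ((A * Q) i j + (B * A.adjugate) i j) +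
      s ^ 2 * ((A * B.adjugate) i j + (B * Q) i j) + s ^ 3 * (B * B.adjugate) i j = 0
    linear_combination this
  obtain ⟨i, hi⟩ := Function.ne_iff.mp hB
  obtain ⟨j, hij : B.adjugate i j ≠ 0⟩ := Function.ne_iff.mp hi
  refine ⟨(A.adjugate · j), (Q · j), (B.adjugate · j), fun hc => hij (congrFun hc i), ?_⟩
  exact ⟨funext fun k => congrFun (hcoeff k j) 0, funext fun k => congrFun (hcoeff k j) 1,
    funext fun k => congrFun (hcoeff k j) 2, funext fun k => congrFun (hcoeff k j) 3⟩

theorem exists_linear_kernel_of_quadratic_kernel {V V' : Type*} [AddCommGroup V] [Module L V]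
    [AddCommGroup V'] [Module L V'] {A B : V →ₗ[L] V'} {a b c : V}
    (hdep : ¬ LinearIndependent L ![a, b, c]) (h₀ : A a = 0) (h₁ : A b + B a = 0)
    (h₂ : A c + B b = 0) (h₃ : B c = 0) (hc : A c ≠ 0) :
    ∃ a' b', LinearIndependent L ![a', b'] ∧ A a' = 0 ∧ A b' + B a' = 0 ∧ B b' = 0 := by
  have hBb : B b = -A c := eq_neg_of_add_eq_zero_right h₂
  have hbc : LinearIndependent L ![b, c] := by
    rw [LinearIndependent.pair_symm_iff, LinearIndependent.pair_iff' fun h => hc (by simp [h])]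
    rintro x rfl
    rw [map_smul, h₃, smul_zero] at hBb
    exact hc (neg_eq_zero.mp hBb.symm)
  obtain ⟨y, x, rfl⟩ : ∃ y x : L, y • b + x • c = a := by
    have hmem := not_not.mp fun h => hdep (linearIndependent_finCons.mpr ⟨hbc, h⟩)
    rwa [Matrix.range_cons_cons_empty, Submodule.mem_span_pair] at hmem
  have hAb : A b = y • A c := by
    rw [map_add, map_smul, map_smul, h₃, smul_zero, add_zero, hBb, smul_neg] at h₁
    exact add_neg_eq_zero.mp h₁
  refine ⟨b - y • c, c, ?_, by rw [map_sub, map_smul, hAb, sub_self], ?_, h₃⟩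
  · rw [LinearIndependent.pair_iff] at hbc ⊢
    intro s t hst
    obtain ⟨rfl, ht⟩ := hbc s (t - s * y) (by rw [← hst]; module)
    exact ⟨rfl, by simpa using ht⟩
  · rw [map_sub, map_smul, h₃, smul_zero, sub_zero, h₂]

theorem exists_common_left_kernel_of_quadratic_kernel {A B : Matrix (Fin 3) (Fin 3) L}
    {a b c : Fin 3 → L} (hli : LinearIndependent L ![a, b, c]) (h₀ : A *ᵥ a = 0)
    (h₁ : A *ᵥ b + B *ᵥ a = 0) (h₂ : A *ᵥ c + B *ᵥ b = 0) (h₃ : B *ᵥ c = 0) :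
    ∃ w ≠ 0, w ᵥ* A = 0 ∧ w ᵥ* B = 0 := by
  obtain ⟨w, hw, hwS⟩ := Matrix.exists_mulVec_eq_zero_iff.mpr
    (Matrix.det_eq_zero_of_row_eq_zero (A := Matrix.of ![B *ᵥ a, B *ᵥ b, 0]) 2 fun _ => rfl)
  have ha : w ⬝ᵥ B *ᵥ a = 0 := (dotProduct_comm _ _).trans (congrFun hwS 0)
  have hb : w ⬝ᵥ B *ᵥ b = 0 := (dotProduct_comm _ _).trans (congrFun hwS 1)
  have hbasis (C : Matrix (Fin 3) (Fin 3) L) (hCa : w ⬝ᵥ C *ᵥ a = 0) (hCb : w ⬝ᵥ C *ᵥ b = 0)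
      (hCc : w ⬝ᵥ C *ᵥ c = 0) : w ᵥ* C = 0 := by
    have hdet : (Matrix.of ![a, b, c]).det ≠ 0 :=
      ((Matrix.isUnit_iff_isUnit_det _).mp
        (Matrix.linearIndependent_rows_iff_isUnit.mp hli)).ne_zero
    refine Matrix.eq_zero_of_mulVec_eq_zero hdet (funext fun i => ?_)
    rw [Matrix.dotProduct_mulVec, dotProduct_comm] at hCa hCb hCc
    fin_cases i
    exacts [hCa, hCb, hCc]
  refine ⟨w, hw, hbasis A ?_ ?_ ?_, hbasis B ha hb ?_⟩
  · rw [h₀, dotProduct_zero]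
  · rw [eq_neg_of_add_eq_zero_left h₁, dotProduct_neg, ha, neg_zero]
  · rw [eq_neg_of_add_eq_zero_left h₂, dotProduct_neg, hb, neg_zero]
  · rw [h₃, dotProduct_zero]

/-- Kronecker's classification of the singular pencils of 3-by-3 matrices of generic rank two, by
the minimal degree of a polynomial kernel vector. -/
theorem singular_pencil_trichotomy [Infinite L] {A B : Matrix (Fin 3) (Fin 3) L}
    (hdet : ∀ s : L, (A + s • B).det = 0) (hB : B.adjugate ≠ 0) :
    (∃ u ≠ 0, A *ᵥ u = 0 ∧ B *ᵥ u = 0) ∨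
    (∃ a b, LinearIndependent L ![a, b] ∧ A *ᵥ a = 0 ∧ A *ᵥ b + B *ᵥ a = 0 ∧ B *ᵥ b = 0) ∨
    (∃ w ≠ 0, w ᵥ* A = 0 ∧ w ᵥ* B = 0) := by
  obtain ⟨a, b, c, hc, h₀, h₁, h₂, h₃⟩ := exists_quadratic_kernel_of_singular_pencil hdet hB
  by_cases hli : LinearIndependent L ![a, b, c]
  · exact .inr (.inr (exists_common_left_kernel_of_quadratic_kernel hli h₀ h₁ h₂ h₃))
  by_cases hAc : A *ᵥ c = 0
  · exact .inl ⟨c, hc, hAc, h₃⟩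
  · exact .inr (.inl (exists_linear_kernel_of_quadratic_kernel (A := A.mulVecLin)
      (B := B.mulVecLin) hli h₀ h₁ h₂ h₃ hAc))

theorem exists_zeros_of_binary_quadratic [IsAlgClosed L] (k₀ k₁ k₂ : L) :
    (∃ q₁ s₁ q₂ s₂, q₁ * s₂ - q₂ * s₁ ≠ 0 ∧ k₀ * q₁ ^ 2 + k₁ * q₁ * s₁ + k₂ * s₁ ^ 2 = 0 ∧
      k₀ * q₂ ^ 2 + k₁ * q₂ * s₂ + k₂ * s₂ ^ 2 = 0) ∨
    (∃ q s, (q ≠ 0 ∨ s ≠ 0) ∧ k₀ * q ^ 2 + k₁ * q * s + k₂ * s ^ 2 = 0 ∧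
      2 * k₀ * q + k₁ * s = 0 ∧ k₁ * q + 2 * k₂ * s = 0) := by
  by_cases h₂ : k₂ = 0
  · subst h₂
    by_cases h₁ : k₁ = 0
    · exact .inr ⟨0, 1, by simp [h₁]⟩
    · exact .inl ⟨0, 1, k₁, -k₀, by simpa using h₁, by ring, by ring⟩
  · have hdeg : (C k₂ * X ^ 2 + C k₁ * X + C k₀).degree ≠ 0 := by
      rw [degree_quadratic h₂]
      decide
    obtain ⟨r, hr⟩ := IsAlgClosed.exists_root _ hdeg
    have hr : k₂ * r ^ 2 + k₁ * r + k₀ = 0 := by simpa [IsRoot] using hr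
    by_cases hd : k₁ + 2 * k₂ * r = 0
    · exact .inr ⟨1, r, .inl one_ne_zero, by linear_combination hr,
        by linear_combination 2 * hr - r * hd, by linear_combination hd⟩
    · refine .inl ⟨1, r, k₂, -k₁ - k₂ * r, fun h => hd ?_, by linear_combination hr, ?_⟩
      · linear_combination -h
      · linear_combination k₂ ^ 2 * hr

end Pencil

section Syzygies

variable {R : Type*} [CommRing R]

/-- The value at `t` of the monic sextic with signed coefficients `e`. -/
def sextic (e : Fin 6 → R) (t : R) : R :=
  t ^ 6 - e 0 * t ^ 5 + e 1 * t ^ 4 - e 2 * t ^ 3 + e 3 * t ^ 2 - e 4 * t + e 5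

/-- The value at `t` of the derivative of the monic sextic with signed coefficients `e`. -/
def sexticDeriv (e : Fin 6 → R) (t : R) : R :=
  6 * t ^ 5 - 5 * e 0 * t ^ 4 + 4 * e 1 * t ^ 3 - 3 * e 2 * t ^ 2 + 2 * e 3 * t - e 4

/-- Four cubic forms through the six points of the cuspidal cubic whose parameters are the roots
of `sextic e`: the equation of the cuspidal cubic itself, and three cubics that restrict to
`sextic e t`, `t * sextic e t` and `(t ^ 3 + e 0 * t ^ 2) * sextic e t` on it. -/
def cubicMap (e : Fin 6 → R) (u : Fin 3 → R) : Fin 4 → R :=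
  ![u 0 ^ 2 * u 2 - u 1 ^ 3,
    u 0 * u 2 ^ 2 - e 0 * u 1 ^ 2 * u 2 + e 1 * u 0 * u 1 * u 2 - e 2 * u 0 ^ 2 * u 2
      + e 3 * u 0 * u 1 ^ 2 - e 4 * u 0 ^ 2 * u 1 + e 5 * u 0 ^ 3,
    u 1 * u 2 ^ 2 - e 0 * u 0 * u 2 ^ 2 + e 1 * u 1 ^ 2 * u 2 - e 2 * u 0 * u 1 * u 2
      + e 3 * u 0 ^ 2 * u 2 - e 4 * u 0 * u 1 ^ 2 + e 5 * u 0 ^ 2 * u 1,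
    u 2 ^ 3 + (e 1 - e 0 ^ 2) * u 1 * u 2 ^ 2 + (e 0 * e 1 - e 2) * u 0 * u 2 ^ 2
      + (e 3 - e 0 * e 2) * u 1 ^ 2 * u 2 + (e 0 * e 3 - e 4) * u 0 * u 1 * u 2
      + (e 5 - e 0 * e 4) * u 0 ^ 2 * u 2 + e 0 * e 5 * u 0 * u 1 ^ 2]

/-- The derivative of `cubicMap e` at `u` in the direction `w`. -/
def cubicDeriv (e : Fin 6 → R) (u w : Fin 3 → R) : Fin 4 → R :=
  ![2 * u 0 * u 2 * w 0 - 3 * u 1 ^ 2 * w 1 + u 0 ^ 2 * w 2,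
    (u 2 ^ 2 + e 1 * u 1 * u 2 - 2 * e 2 * u 0 * u 2 + e 3 * u 1 ^ 2 - 2 * e 4 * u 0 * u 1
        + 3 * e 5 * u 0 ^ 2) * w 0
      + (-2 * e 0 * u 1 * u 2 + e 1 * u 0 * u 2 + 2 * e 3 * u 0 * u 1 - e 4 * u 0 ^ 2) * w 1
      + (2 * u 0 * u 2 - e 0 * u 1 ^ 2 + e 1 * u 0 * u 1 - e 2 * u 0 ^ 2) * w 2,
    (-e 0 * u 2 ^ 2 - e 2 * u 1 * u 2 + 2 * e 3 * u 0 * u 2 - e 4 * u 1 ^ 2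
        + 2 * e 5 * u 0 * u 1) * w 0
      + (u 2 ^ 2 + 2 * e 1 * u 1 * u 2 - e 2 * u 0 * u 2 - 2 * e 4 * u 0 * u 1
        + e 5 * u 0 ^ 2) * w 1
      + (2 * u 1 * u 2 - 2 * e 0 * u 0 * u 2 + e 1 * u 1 ^ 2 - e 2 * u 0 * u 1
        + e 3 * u 0 ^ 2) * w 2,
    ((e 0 * e 1 - e 2) * u 2 ^ 2 + (e 0 * e 3 - e 4) * u 1 * u 2
        + 2 * (e 5 - e 0 * e 4) * u 0 * u 2 + e 0 * e 5 * u 1 ^ 2) * w 0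
      + ((e 1 - e 0 ^ 2) * u 2 ^ 2 + 2 * (e 3 - e 0 * e 2) * u 1 * u 2
        + (e 0 * e 3 - e 4) * u 0 * u 2 + 2 * e 0 * e 5 * u 0 * u 1) * w 1
      + (3 * u 2 ^ 2 + 2 * (e 1 - e 0 ^ 2) * u 1 * u 2 + 2 * (e 0 * e 1 - e 2) * u 0 * u 2
        + (e 3 - e 0 * e 2) * u 1 ^ 2 + (e 0 * e 3 - e 4) * u 0 * u 1
        + (e 5 - e 0 * e 4) * u 0 ^ 2) * w 2]

/-- The matrix of the three linear syzygies of `cubicMap e`: its rows, paired with `u`, are linear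
in `u` and in `v`, and vanish for `v = cubicMap e u`. -/
def syzMatrix (e : Fin 6 → R) : (Fin 4 → R) →ₗ[R] Matrix (Fin 3) (Fin 3) R where
  toFun v := !![v 2 - e 3 * v 0, -v 1, e 0 * v 0;
    v 3 + e 0 * e 4 * v 0, -e 0 * v 2, -v 1 - e 0 * e 1 * v 0;
    e 0 * e 5 * v 0, v 3, -v 2 - e 0 * v 1 - (e 0 * e 2 - e 3) * v 0]
  map_add' v w := by
    ext i j
    fin_cases i <;> fin_cases j <;> simp <;> ring
  map_smul' a v := by
    ext i j
    fin_cases i <;> fin_cases j <;> simp <;> ring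

/-- The matrix of the same three bilinear forms as `syzMatrix`, regarded as linear forms in the
other variable `v`. -/
def pointMatrix (e : Fin 6 → R) (u : Fin 3 → R) : Matrix (Fin 3) (Fin 4) R :=
  !![e 0 * u 2 - e 3 * u 0, -u 1, u 0, 0;
    e 0 * e 4 * u 0 - e 0 * e 1 * u 2, -u 2, -e 0 * u 1, u 0;
    e 0 * e 5 * u 0 - (e 0 * e 2 - e 3) * u 2, -e 0 * u 2, -u 2, u 1]

variable (e : Fin 6 → R)

theorem syzMatrix_apply (v : Fin 4 → R) :
    syzMatrix e v = !![v 2 - e 3 * v 0, -v 1, e 0 * v 0;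
      v 3 + e 0 * e 4 * v 0, -e 0 * v 2, -v 1 - e 0 * e 1 * v 0;
      e 0 * e 5 * v 0, v 3, -v 2 - e 0 * v 1 - (e 0 * e 2 - e 3) * v 0] :=
  rfl

theorem syzMatrix_mulVec (v : Fin 4 → R) (u : Fin 3 → R) :
    syzMatrix e v *ᵥ u =
      ![(v 2 - e 3 * v 0) * u 0 - v 1 * u 1 + e 0 * v 0 * u 2,
        (v 3 + e 0 * e 4 * v 0) * u 0 - e 0 * v 2 * u 1 - (v 1 + e 0 * e 1 * v 0) * u 2,
        e 0 * e 5 * v 0 * u 0 + v 3 * u 1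
          - (v 2 + e 0 * v 1 + (e 0 * e 2 - e 3) * v 0) * u 2] := by
  ext i
  fin_cases i <;> simp [syzMatrix_apply, Matrix.mulVec, dotProduct, Fin.sum_univ_three] <;> ring

theorem vecMul_syzMatrix (v : Fin 4 → R) (w : Fin 3 → R) :
    w ᵥ* syzMatrix e v =
      ![w 0 * (v 2 - e 3 * v 0) + w 1 * (v 3 + e 0 * e 4 * v 0) + w 2 * (e 0 * e 5 * v 0),
        -w 0 * v 1 - w 1 * (e 0 * v 2) + w 2 * v 3,
        w 0 * (e 0 * v 0) - w 1 * (v 1 + e 0 * e 1 * v 0)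
          - w 2 * (v 2 + e 0 * v 1 + (e 0 * e 2 - e 3) * v 0)] := by
  ext i
  fin_cases i <;> simp [syzMatrix_apply, Matrix.vecMul, dotProduct, Fin.sum_univ_three] <;> ring

theorem pointMatrix_mulVec (u : Fin 3 → R) (v : Fin 4 → R) :
    pointMatrix e u *ᵥ v = syzMatrix e v *ᵥ u := by
  rw [syzMatrix_mulVec]
  ext i
  fin_cases i <;> simp [pointMatrix, Matrix.mulVec, dotProduct, Fin.sum_univ_four] <;> ring

theorem maximalMinors_pointMatrix (u : Fin 3 → R) :
    maximalMinors (pointMatrix e u) = -e 0 • cubicMap e u := by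
  ext j
  fin_cases j <;>
    simp [maximalMinors, pointMatrix, cubicMap, Matrix.det_fin_three, Fin.succAbove,
      Fin.lt_def] <;> ring

theorem syzMatrix_cubicMap_mulVec (u : Fin 3 → R) : syzMatrix e (cubicMap e u) *ᵥ u = 0 := by
  rw [syzMatrix_mulVec]
  ext j
  fin_cases j <;> simp [cubicMap] <;> ring

theorem map_cubicMap {S : Type*} [CommRing S] (φ : R →+* S) (u : Fin 3 → R) (j : Fin 4) :
    φ (cubicMap e u j) = cubicMap (φ ∘ e) (φ ∘ u) j := by
  fin_cases j <;> simp [cubicMap]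

theorem map_syzMatrix {S : Type*} [CommRing S] (φ : R →+* S) (v : Fin 4 → R) :
    (syzMatrix e v).map φ = syzMatrix (φ ∘ e) (φ ∘ v) := by
  ext i j
  fin_cases i <;> fin_cases j <;> simp [syzMatrix_apply]

theorem cubicMap_smul (a : R) (u : Fin 3 → R) : cubicMap e (a • u) = a ^ 3 • cubicMap e u := by
  ext j
  fin_cases j <;> simp [cubicMap] <;> ring

theorem cubicDeriv_smul_left (a : R) (u w : Fin 3 → R) :
    cubicDeriv e (a • u) w = a ^ 2 • cubicDeriv e u w := by
  ext j
  fin_cases j <;> simp [cubicDeriv] <;> ring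

theorem cubicDeriv_smul_right (a : R) (u w : Fin 3 → R) :
    cubicDeriv e u (a • w) = a • cubicDeriv e u w := by
  ext j
  fin_cases j <;> simp [cubicDeriv] <;> ring

theorem cubicMap_add_smul (a : R) (u w : Fin 3 → R) :
    cubicMap e (u + a • w) =
      cubicMap e u + a • cubicDeriv e u w + a ^ 2 • cubicDeriv e w u + a ^ 3 • cubicMap e w := by
  ext j
  fin_cases j <;> simp [cubicMap, cubicDeriv] <;> ring

theorem syzMatrix_cubicDeriv_mulVec (u w : Fin 3 → R) :
    syzMatrix e (cubicDeriv e u w) *ᵥ u + syzMatrix e (cubicMap e u) *ᵥ w = 0 := by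
  rw [syzMatrix_mulVec, syzMatrix_mulVec]
  ext j
  fin_cases j <;> simp [cubicMap, cubicDeriv] <;> ring

theorem syzMatrix_cubicDeriv_add (u w : Fin 3 → R) :
    syzMatrix e (cubicDeriv e u w) *ᵥ w + syzMatrix e (cubicDeriv e w u) *ᵥ u = 0 := by
  rw [syzMatrix_mulVec, syzMatrix_mulVec]
  ext j
  fin_cases j <;> simp [cubicDeriv] <;> ring

end Syzygies

section GeneralPosition

variable {L : Type*} [Field L] {e θ : Fin 6 → L} {u : Fin 3 → L} {v : Fin 4 → L}

/-- The roots of `sextic e` are the `θ i`; they are simple and satisfy the conditions of general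
position of the `E6` arrangement. Here `e 0` is the sum of the roots. -/
structure GeneralSextic (e θ : Fin 6 → L) : Prop where
  injective : Function.Injective θ
  sextic_eq_zero_iff : ∀ t, sextic e t = 0 ↔ ∃ i, θ i = t
  sexticDeriv_ne_zero : ∀ i, sexticDeriv e (θ i) ≠ 0
  add_add_ne_zero : ∀ i j k, i ≠ j → j ≠ k → i ≠ k → θ i + θ j + θ k ≠ 0
  coeff_ne_zero : e 0 ≠ 0

theorem GeneralSextic.sextic_eq_zero (h : GeneralSextic e θ) (i : Fin 6) : sextic e (θ i) = 0 :=
  (h.sextic_eq_zero_iff _).mpr ⟨i, rfl⟩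

theorem eq_smul_cubicMap (h0 : e 0 ≠ 0) (hu : cubicMap e u ≠ 0) (h : syzMatrix e v *ᵥ u = 0) :
    ∃ c : L, v = c • cubicMap e u := by
  have hN : maximalMinors (pointMatrix e u) ≠ 0 := by
    rw [maximalMinors_pointMatrix]
    exact smul_ne_zero (neg_ne_zero.mpr h0) hu
  obtain ⟨c, hc⟩ := exists_eq_smul_maximalMinors hN ((pointMatrix_mulVec e u v).trans h)
  rw [maximalMinors_pointMatrix, smul_smul] at hc
  exact ⟨_, hc⟩

theorem cubicMap_eq_zero_of_forall_dotProduct (h0 : e 0 ≠ 0) {w : Fin 3 → L} (hw : w ≠ 0)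
    (h : ∀ v, w ⬝ᵥ (syzMatrix e v *ᵥ u) = 0) : cubicMap e u = 0 := by
  have hwN : w ᵥ* pointMatrix e u = 0 := dotProduct_eq_zero _ fun v => by
    rw [← Matrix.dotProduct_mulVec, pointMatrix_mulVec, h]
  have := maximalMinors_eq_zero_of_vecMul_eq_zero hw hwN
  rw [maximalMinors_pointMatrix] at this
  exact (smul_eq_zero.mp this).resolve_left (neg_ne_zero.mpr h0)

theorem cuspPoint_ne_zero (t : L) : cuspPoint t ≠ 0 := fun h =>
  one_ne_zero (congrFun h 0)

theorem eq_of_cuspPoint_eq_smul {s t c : L} (h : cuspPoint s = c • cuspPoint t) : s = t := by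
  have hc : 1 = c * 1 := congrFun h 0
  have hs : s = c * t := congrFun h 1
  linear_combination hs - t * hc

theorem cubicMap_cuspPoint (e : Fin 6 → L) (t : L) :
    cubicMap e (cuspPoint t) =
      ![0, sextic e t, t * sextic e t, (t ^ 3 + e 0 * t ^ 2) * sextic e t] := by
  ext j
  fin_cases j <;> simp [cubicMap, cuspPoint, sextic] <;> ring

theorem cubicMap_cuspPoint_eq_zero (h : GeneralSextic e θ) (i : Fin 6) :
    cubicMap e (cuspPoint (θ i)) = 0 := by
  rw [cubicMap_cuspPoint, h.sextic_eq_zero]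
  ext j
  fin_cases j <;> simp

theorem exists_eq_smul_cuspPoint (h : GeneralSextic e θ) (hu : u ≠ 0) (hc : cubicMap e u = 0) :
    ∃ i, ∃ c : L, c ≠ 0 ∧ u = c • cuspPoint (θ i) := by
  have hcusp : u 0 ^ 2 * u 2 - u 1 ^ 3 = 0 := congrFun hc 0
  have hx : u 0 ≠ 0 := fun hx => by
    have hy : u 1 = 0 := by simpa [hx] using hcusp
    have hz : u 2 = 0 := by simpa [cubicMap, hx, hy] using congrFun hc 3
    refine hu (funext fun j => ?_)
    fin_cases j <;> assumption
  have hu' : u = u 0 • cuspPoint (u 1 / u 0) := by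
    ext j
    fin_cases j
    · simp [cuspPoint]
    · simp [cuspPoint, mul_div_cancel₀ _ hx]
    · change u 2 = u 0 * (u 1 / u 0) ^ 3
      field_simp
      linear_combination hcusp
  rw [hu', cubicMap_smul, cubicMap_cuspPoint] at hc
  obtain ⟨i, hi⟩ := (h.sextic_eq_zero_iff _).mp
    ((mul_eq_zero.mp (congrFun hc 1)).resolve_left (pow_ne_zero 3 hx))
  exact ⟨i, u 0, hx, hi ▸ hu'⟩

theorem eq_zero_of_adjugate_of_apply_zero (h0 : e 0 ≠ 0) (hv : v 0 = 0)
    (hadj : (syzMatrix e v).adjugate = 0) : v = 0 := by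
  have minor (i j : Fin 3) := congrFun (congrFun hadj i) j
  have h1 : v 1 = 0 := by
    simpa [syzMatrix_apply, Matrix.adjugate_fin_three, hv] using minor 0 2
  have h2 : v 2 = 0 := by
    simpa [syzMatrix_apply, Matrix.adjugate_fin_three, hv, h1, h0] using minor 0 0
  have h3 : v 3 = 0 := by
    simpa [syzMatrix_apply, Matrix.adjugate_fin_three, hv, h1, h2, h0] using minor 2 0
  ext j
  fin_cases j <;> assumption

theorem exists_sextic_eq_mul_of_adjugate_eq_zero (h0 : e 0 ≠ 0) (hv : v 0 = 1)
    (hadj : (syzMatrix e v).adjugate = 0) :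
    ∃ β n γ μ, ∀ t, sextic e t = (t ^ 3 - β * t + n) * (t ^ 3 - e 0 * t ^ 2 + γ * t + μ) ∧
      sexticDeriv e t = (3 * t ^ 2 - β) * (t ^ 3 - e 0 * t ^ 2 + γ * t + μ) +
        (t ^ 3 - β * t + n) * (3 * t ^ 2 - 2 * e 0 * t + γ) := by
  obtain ⟨β, hβ⟩ : ∃ β, v 1 = e 0 * β := ⟨v 1 / e 0, (mul_div_cancel₀ _ h0).symm⟩
  obtain ⟨n, hn⟩ : ∃ n, v 2 = e 0 * n + e 3 :=
    ⟨(v 2 - e 3) / e 0, by rw [mul_div_cancel₀ _ h0, sub_add_cancel]⟩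
  obtain ⟨μ, hμ⟩ : ∃ μ, μ = -n - e 0 * β - e 2 := ⟨_, rfl⟩
  rw [syzMatrix_apply, Matrix.adjugate_fin_three] at hadj
  have minor (i j : Fin 3) := congrFun (congrFun hadj i) j
  have m01 : -(-v 1 * (-v 2 - e 0 * v 1 - (e 0 * e 2 - e 3) * v 0)) + e 0 * v 0 * v 3 = 0 :=
    minor 0 1
  have m02 : -v 1 * (-v 1 - e 0 * e 1 * v 0) - e 0 * v 0 * (-e 0 * v 2) = 0 := minor 0 2
  have m11 : (v 2 - e 3 * v 0) * (-v 2 - e 0 * v 1 - (e 0 * e 2 - e 3) * v 0)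
      - e 0 * v 0 * (e 0 * e 5 * v 0) = 0 := minor 1 1
  have m12 : -((v 2 - e 3 * v 0) * (-v 1 - e 0 * e 1 * v 0))
      + e 0 * v 0 * (v 3 + e 0 * e 4 * v 0) = 0 := minor 1 2
  rw [hv, hβ] at m01 m02
  rw [hv, hβ, hn] at m11 m12
  rw [hn] at m01 m02
  have E2 : e 2 = -n - e 0 * β - μ := by linear_combination hμ
  have E3 : e 3 = -β * (β + e 1) - e 0 * n :=
    mul_left_cancel₀ (pow_ne_zero 2 h0) (by linear_combination m02)
  have E4 : e 4 = β * μ - n * (β + e 1) :=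
    mul_left_cancel₀ (pow_ne_zero 2 h0)
      (by linear_combination m12 - m01 - e 0 ^ 2 * β * hμ)
  have E5 : e 5 = n * μ :=
    mul_left_cancel₀ (pow_ne_zero 2 h0) (by linear_combination -m11 - e 0 ^ 2 * n * hμ)
  refine ⟨β, n, β + e 1, μ, fun t => ⟨?_, ?_⟩⟩
  · rw [sextic, E2, E3, E4, E5]
    ring
  · rw [sexticDeriv, E2, E3, E4]
    ring

theorem exists_roots_of_depressed_cubic [IsAlgClosed L] (β n : L) :
    ∃ r s, β = r ^ 2 + r * s + s ^ 2 ∧ n = r * s * (r + s) := by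
  obtain ⟨r, hr⟩ : ∃ r : L, r ^ 3 - β * r + n = 0 := by
    have hdeg : (X ^ 3 - C β * X + C n : L[X]).degree = 3 := by compute_degree!
    obtain ⟨r, hr⟩ := IsAlgClosed.exists_root _ (by rw [hdeg]; decide)
    exact ⟨r, by simpa using hr⟩
  obtain ⟨s, hs⟩ : ∃ s : L, s ^ 2 + r * s + (r ^ 2 - β) = 0 := by
    have hdeg : (X ^ 2 + C r * X + C (r ^ 2 - β) : L[X]).degree = 2 := by compute_degree!
    obtain ⟨s, hs⟩ := IsAlgClosed.exists_root _ (by rw [hdeg]; decide)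
    exact ⟨s, by simpa using hs⟩
  exact ⟨r, s, by linear_combination -hs, by linear_combination hr - r * hs⟩

/-- If `syzMatrix e v` had rank at most one, the sextic would be divisible by a cubic without
quadratic term, and three of the six roots would have sum zero. -/
theorem eq_zero_of_adjugate_eq_zero [IsAlgClosed L] (h : GeneralSextic e θ)
    (hadj : (syzMatrix e v).adjugate = 0) : v = 0 := by
  by_cases hv : v 0 = 0
  · exact eq_zero_of_adjugate_of_apply_zero h.coeff_ne_zero hv hadj
  exfalso
  obtain ⟨β, n, γ, μ, hfac⟩ := exists_sextic_eq_mul_of_adjugate_eq_zero h.coeff_ne_zero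
    (v := (v 0)⁻¹ • v) (inv_mul_cancel₀ hv) (by
      rw [map_smul, Matrix.adjugate_smul, hadj, smul_zero])
  obtain ⟨r, s, rfl, rfl⟩ := exists_roots_of_depressed_cubic β n
  have exists_root (t : L) (ht : (t - r) * (t - s) * (t + r + s) = 0) : ∃ i, θ i = t := by
    refine (h.sextic_eq_zero_iff t).mp ?_
    rw [(hfac t).1]
    linear_combination (t ^ 3 - e 0 * t ^ 2 + γ * t + μ) * ht
  have deriv_ne_zero (i : Fin 6) (ht : (θ i - r) * (θ i - s) * (θ i + r + s) = 0) :
      (θ i - s) * (θ i + r + s) + (θ i - r) * (θ i + r + s) + (θ i - r) * (θ i - s) ≠ 0 := by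
    intro hd
    refine h.sexticDeriv_ne_zero i ?_
    rw [(hfac _).2]
    linear_combination (θ i ^ 3 - e 0 * θ i ^ 2 + γ * θ i + μ) * hd +
      (3 * θ i ^ 2 - 2 * e 0 * θ i + γ) * ht
  obtain ⟨i, hi⟩ := exists_root r (by ring)
  obtain ⟨j, hj⟩ := exists_root s (by ring)
  obtain ⟨k, hk⟩ := exists_root (-r - s) (by ring)
  subst hi hj
  refine h.add_add_ne_zero i j k ?_ ?_ ?_ (by rw [hk]; ring)
  · rintro rfl
    exact deriv_ne_zero i (by ring) (by ring)
  · rintro rfl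
    exact deriv_ne_zero j (by ring) (by linear_combination (θ j - θ i) * hk)
  · rintro rfl
    exact deriv_ne_zero i (by ring) (by linear_combination (θ i - θ j) * hk)

theorem eq_zero_of_linearIndependent_of_mulVec_eq_zero [IsAlgClosed L] (h : GeneralSextic e θ)
    {u' : Fin 3 → L} (hli : LinearIndependent L ![u, u']) (hu : syzMatrix e v *ᵥ u = 0)
    (hu' : syzMatrix e v *ᵥ u' = 0) : v = 0 :=
  eq_zero_of_adjugate_eq_zero h (adjugate_eq_zero_of_linearIndependent hli hu hu')

theorem eq_smul_of_mulVec_eq_zero [IsAlgClosed L] (h : GeneralSextic e θ) (hv : v ≠ 0)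
    {u' : Fin 3 → L} (hu0 : u ≠ 0) (hu : syzMatrix e v *ᵥ u = 0)
    (hu' : syzMatrix e v *ᵥ u' = 0) : ∃ c : L, u' = c • u := by
  by_contra! hc
  refine hv (eq_zero_of_linearIndependent_of_mulVec_eq_zero h ?_ hu hu')
  exact (LinearIndependent.pair_iff' hu0).mpr fun a ha => hc a ha.symm

end GeneralPosition

section LinesOverPoints

variable {L : Type*} [Field L] {e θ : Fin 6 → L} {v : Fin 4 → L} {t : L}

/-- The left kernel of the pencil of matrices `syzMatrix e v` along the line of the cubic surface
that is the image of the conic through all six points but `cuspPoint t`. -/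
def leftPoint (e : Fin 6 → L) (t : L) : Fin 3 → L := ![t ^ 3 - e 0 * t ^ 2, -t, 1]

/-- The line of the cubic surface lying over the point `cuspPoint t` of the plane. -/
def exceptionalLine (e : Fin 6 → L) (t : L) : Submodule L (Fin 4 → L) :=
  LinearMap.ker (pointMatrix e (cuspPoint t)).mulVecLin

/-- The line of the cubic surface that is the image of the conic through all six points but
`cuspPoint t`. -/
def conicLine (e : Fin 6 → L) (t : L) : Submodule L (Fin 4 → L) :=
  LinearMap.ker (Matrix.vecMulBilin L L (leftPoint e t) ∘ₗ syzMatrix e)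

theorem leftPoint_ne_zero (e : Fin 6 → L) (t : L) : leftPoint e t ≠ 0 := fun h =>
  one_ne_zero (congrFun h 2)

theorem mem_exceptionalLine : v ∈ exceptionalLine e t ↔ syzMatrix e v *ᵥ cuspPoint t = 0 := by
  rw [exceptionalLine, LinearMap.mem_ker, Matrix.mulVecLin_apply, pointMatrix_mulVec]

theorem mem_conicLine : v ∈ conicLine e t ↔ leftPoint e t ᵥ* syzMatrix e v = 0 :=
  Iff.rfl

theorem syzMatrix_mulVec_cuspPoint (e : Fin 6 → L) (v : Fin 4 → L) (t : L) :
    syzMatrix e v *ᵥ cuspPoint t =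
      ![v 2 - e 3 * v 0 - t * v 1 + t ^ 3 * (e 0 * v 0),
        v 3 + e 0 * e 4 * v 0 - t * (e 0 * v 2) - t ^ 3 * (v 1 + e 0 * e 1 * v 0),
        e 0 * e 5 * v 0 + t * v 3
          - t ^ 3 * (v 2 + e 0 * v 1 + (e 0 * e 2 - e 3) * v 0)] := by
  rw [syzMatrix_mulVec]
  ext j
  fin_cases j <;> simp [cuspPoint] <;> ring

theorem leftPoint_vecMul_syzMatrix (e : Fin 6 → L) (v : Fin 4 → L) (t : L) :
    leftPoint e t ᵥ* syzMatrix e v =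
      ![(t ^ 3 - e 0 * t ^ 2) * (v 2 - e 3 * v 0) - t * (v 3 + e 0 * e 4 * v 0)
          + e 0 * e 5 * v 0,
        -(t ^ 3 - e 0 * t ^ 2) * v 1 + t * (e 0 * v 2) + v 3,
        (t ^ 3 - e 0 * t ^ 2) * (e 0 * v 0) + t * (v 1 + e 0 * e 1 * v 0)
          - (v 2 + e 0 * v 1 + (e 0 * e 2 - e 3) * v 0)] := by
  rw [vecMul_syzMatrix]
  ext j
  fin_cases j <;> simp [leftPoint]
  ring

theorem eq_smul_leftPoint {w : Fin 3 → L}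
    (h : ∀ v, w ⬝ᵥ (syzMatrix e v *ᵥ cuspPoint t) = 0) : w = w 2 • leftPoint e t := by
  have hw1 : w 1 + w 2 * t = 0 := by
    simpa [syzMatrix_mulVec_cuspPoint, dotProduct, Fin.sum_univ_three] using h ![0, 0, 0, 1]
  have hw0 : w 0 - w 1 * (t * e 0) - w 2 * t ^ 3 = 0 := by
    simpa [syzMatrix_mulVec_cuspPoint, dotProduct, Fin.sum_univ_three, sub_eq_add_neg] using
      h ![0, 0, 1, 0]
  ext j
  fin_cases j
  · change w 0 = w 2 * (t ^ 3 - e 0 * t ^ 2)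
    linear_combination hw0 + e 0 * t * hw1
  · change w 1 = w 2 * -t
    linear_combination hw1
  · exact (mul_one _).symm

theorem mem_exceptionalLine_iff (h : GeneralSextic e θ) (i : Fin 6) :
    v ∈ exceptionalLine e (θ i) ↔
      v 2 = (e 3 - e 0 * θ i ^ 3) * v 0 + θ i * v 1 ∧
      v 3 = e 0 * (θ i * e 3 - e 0 * θ i ^ 4 + e 1 * θ i ^ 3 - e 4) * v 0
        + (θ i ^ 3 + e 0 * θ i ^ 2) * v 1 := by
  have hP := h.sextic_eq_zero i
  rw [sextic] at hP
  simp only [mem_exceptionalLine, syzMatrix_mulVec_cuspPoint, Matrix.cons_eq_zero_iff,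
    Matrix.zero_empty, and_true]
  constructor
  · rintro ⟨r0, r1, -⟩
    exact ⟨by linear_combination r0, by linear_combination r1 + e 0 * θ i * r0⟩
  · rintro ⟨h2, h3⟩
    rw [h3, h2]
    exact ⟨by ring, by ring, by linear_combination e 0 * v 0 * hP⟩

theorem mem_conicLine_iff (h : GeneralSextic e θ) (i : Fin 6) :
    v ∈ conicLine e (θ i) ↔
      v 2 = (e 0 * (θ i ^ 3 - e 0 * θ i ^ 2 + e 1 * θ i - e 2) + e 3) * v 0
        + (θ i - e 0) * v 1 ∧
      v 3 = - e 0 * θ i * (e 0 * (θ i ^ 3 - e 0 * θ i ^ 2 + e 1 * θ i - e 2) + e 3) * v 0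
        + θ i * (θ i - e 0) ^ 2 * v 1 := by
  have hP := h.sextic_eq_zero i
  rw [sextic] at hP
  simp only [mem_conicLine, leftPoint_vecMul_syzMatrix, Matrix.cons_eq_zero_iff,
    Matrix.zero_empty, and_true]
  constructor
  · rintro ⟨-, r1, r2⟩
    exact ⟨by linear_combination -r2, by linear_combination r1 + e 0 * θ i * r2⟩
  · rintro ⟨h2, h3⟩
    rw [h3, h2]
    exact ⟨by linear_combination e 0 * v 0 * hP, by ring, by ring⟩

theorem finrank_eq_two_of_forall_mem_iff {W : Submodule L (Fin 4 → L)} {α τ γ δ : L}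
    (hW : ∀ v, v ∈ W ↔ v 2 = α * v 0 + τ * v 1 ∧ v 3 = γ * v 0 + δ * v 1) :
    Module.finrank L W = 2 := by
  have hli : LinearIndependent L ![![1, 0, α, γ], ![0, 1, τ, δ]] :=
    LinearIndependent.pair_iff.mpr fun a b hab =>
      ⟨by simpa using congrFun hab 0, by simpa using congrFun hab 1⟩
  have hspan : W = Submodule.span L {![1, 0, α, γ], ![0, 1, τ, δ]} := by
    ext v
    rw [hW, Submodule.mem_span_pair]
    constructor
    · rintro ⟨h2, h3⟩
      refine ⟨v 0, v 1, ?_⟩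
      ext j
      fin_cases j <;> simp [h2, h3, mul_comm]
    · rintro ⟨a, b, rfl⟩
      simp [mul_comm]
  rw [hspan, ← Matrix.range_cons_cons_empty _ _ ![], finrank_span_eq_card hli, Fintype.card_fin]

theorem finrank_exceptionalLine (h : GeneralSextic e θ) (i : Fin 6) :
    Module.finrank L (exceptionalLine e (θ i)) = 2 :=
  finrank_eq_two_of_forall_mem_iff fun _ => mem_exceptionalLine_iff h i

theorem finrank_conicLine (h : GeneralSextic e θ) (i : Fin 6) :
    Module.finrank L (conicLine e (θ i)) = 2 :=
  finrank_eq_two_of_forall_mem_iff fun _ => mem_conicLine_iff h i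

theorem disjoint_exceptionalLine_conicLine (h : GeneralSextic e θ) (i : Fin 6) :
    Disjoint (exceptionalLine e (θ i)) (conicLine e (θ i)) := by
  rw [Submodule.disjoint_def]
  intro v hr hl
  obtain ⟨h2, h3⟩ := (mem_exceptionalLine_iff h i).mp hr
  obtain ⟨h2', h3'⟩ := (mem_conicLine_iff h i).mp hl
  have hv1 : v 1 = (2 * θ i ^ 3 - e 0 * θ i ^ 2 + e 1 * θ i - e 2) * v 0 :=
    mul_left_cancel₀ h.coeff_ne_zero (by linear_combination h2' - h2)
  have hd : e 0 * sexticDeriv e (θ i) * v 0 = 0 := by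
    rw [sexticDeriv]
    linear_combination h3' - h3 + (e 0 ^ 2 * θ i - 3 * e 0 * θ i ^ 2) * hv1
  have hv0 : v 0 = 0 :=
    (mul_eq_zero.mp hd).resolve_left (mul_ne_zero h.coeff_ne_zero (h.sexticDeriv_ne_zero i))
  rw [hv0, mul_zero] at hv1
  rw [hv0, hv1, mul_zero, mul_zero, add_zero] at h2 h3
  ext j
  fin_cases j <;> assumption

theorem eq_zero_of_trace_adjugate_mul [IsAlgClosed L] (h : GeneralSextic e θ)
    (hdet : (syzMatrix e v).det = 0)
    (htr : ∀ v', ((syzMatrix e v).adjugate * syzMatrix e v').trace = 0) : v = 0 := by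
  by_contra hv
  obtain ⟨u, hu, hvu⟩ := Matrix.exists_mulVec_eq_zero_iff.mpr hdet
  obtain ⟨w, hadj, hwv⟩ := exists_adjugate_eq_vecMulVec hdet hu fun _ hx =>
    eq_smul_of_mulVec_eq_zero h hv hu hvu hx
  have hw : w ≠ 0 := by
    rintro rfl
    exact hv (eq_zero_of_adjugate_eq_zero h (hadj.trans (Matrix.vecMulVec_zero u)))
  have hwu (v') : w ⬝ᵥ (syzMatrix e v' *ᵥ u) = 0 := by
    rw [← trace_vecMulVec_mul, ← hadj, htr]
  obtain ⟨i, c, hc, rfl⟩ :=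
    exists_eq_smul_cuspPoint h hu (cubicMap_eq_zero_of_forall_dotProduct h.coeff_ne_zero hw hwu)
  have hw' : w = w 2 • leftPoint e (θ i) := eq_smul_leftPoint fun v' => by
    have := hwu v'
    rw [Matrix.mulVec_smul, dotProduct_smul] at this
    exact (smul_eq_zero.mp this).resolve_left hc
  have hw2 : w 2 ≠ 0 := fun h2 => hw (by rw [hw', h2, zero_smul])
  rw [hw', Matrix.smul_vecMul, smul_eq_zero_iff_right hw2] at hwv
  rw [Matrix.mulVec_smul, smul_eq_zero_iff_right hc] at hvu
  exact hv (Submodule.disjoint_def.mp (disjoint_exceptionalLine_conicLine h i) v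
    (mem_exceptionalLine.mpr hvu) hwv)

theorem cubicDeriv_mem_exceptionalLine (h : GeneralSextic e θ) (i : Fin 6) (w : Fin 3 → L) :
    cubicDeriv e (cuspPoint (θ i)) w ∈ exceptionalLine e (θ i) := by
  have := syzMatrix_cubicDeriv_mulVec e (cuspPoint (θ i)) w
  rwa [cubicMap_cuspPoint_eq_zero h, map_zero, Matrix.zero_mulVec, add_zero,
    ← mem_exceptionalLine] at this

theorem cubicDeriv_cuspPoint_apply_zero (e : Fin 6 → L) (t : L) (w : Fin 3 → L) :
    cubicDeriv e (cuspPoint t) w 0 = 2 * t ^ 3 * w 0 - 3 * t ^ 2 * w 1 + w 2 := by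
  simp [cubicDeriv, cuspPoint]

theorem cubicDeriv_cuspPoint_apply_one (e : Fin 6 → L) (t : L) (w : Fin 3 → L) :
    cubicDeriv e (cuspPoint t) w 1 =
      (t ^ 6 + e 1 * t ^ 4 - 2 * e 2 * t ^ 3 + e 3 * t ^ 2 - 2 * e 4 * t + 3 * e 5) * w 0
        + (-2 * e 0 * t ^ 4 + e 1 * t ^ 3 + 2 * e 3 * t - e 4) * w 1
        + (2 * t ^ 3 - e 0 * t ^ 2 + e 1 * t - e 2) * w 2 := by
  simp [cubicDeriv, cuspPoint]
  ring

theorem exists_cubicDeriv_eq (h : GeneralSextic e θ) (i : Fin 6)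
    (hv : v ∈ exceptionalLine e (θ i)) : ∃ w, cubicDeriv e (cuspPoint (θ i)) w = v := by
  set t := θ i
  set y := (v 1 - (2 * t ^ 3 - e 0 * t ^ 2 + e 1 * t - e 2) * v 0) / sexticDeriv e t with hy
  rw [eq_div_iff (h.sexticDeriv_ne_zero i), sexticDeriv] at hy
  set w : Fin 3 → L := ![0, y, v 0 + 3 * t ^ 2 * y]
  have h0 : cubicDeriv e (cuspPoint t) w 0 = v 0 := by
    simp [cubicDeriv_cuspPoint_apply_zero, w]
  have h1 : cubicDeriv e (cuspPoint t) w 1 = v 1 := by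
    simp only [cubicDeriv_cuspPoint_apply_one, w, Matrix.cons_val]
    linear_combination hy
  obtain ⟨h2, h3⟩ := (mem_exceptionalLine_iff h i).mp hv
  obtain ⟨h2', h3'⟩ := (mem_exceptionalLine_iff h i).mp (cubicDeriv_mem_exceptionalLine h i w)
  rw [h0, h1, ← h2] at h2'
  rw [h0, h1, ← h3] at h3'
  refine ⟨w, funext fun j => ?_⟩
  fin_cases j
  exacts [h0, h1, h2', h3']

theorem eq_smul_of_cubicDeriv_eq_zero (h : GeneralSextic e θ) (i : Fin 6) {w : Fin 3 → L}
    (hw : cubicDeriv e (cuspPoint (θ i)) w = 0) : w = w 0 • cuspPoint (θ i) := by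
  have hd := h.sexticDeriv_ne_zero i
  have hP := h.sextic_eq_zero i
  rw [sexticDeriv] at hd
  rw [sextic] at hP
  set t := θ i
  have h0 := (cubicDeriv_cuspPoint_apply_zero e t w).symm.trans (congrFun hw 0)
  have h1 := (cubicDeriv_cuspPoint_apply_one e t w).symm.trans (congrFun hw 1)
  simp only [Pi.zero_apply] at h0 h1
  have hy : w 1 = w 0 * t := mul_left_cancel₀ hd (by
    linear_combination h1 - (2 * t ^ 3 - e 0 * t ^ 2 + e 1 * t - e 2) * h0 - 3 * w 0 * hP)
  ext j
  fin_cases j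
  · exact (mul_one _).symm
  · exact hy
  · change w 2 = w 0 * t ^ 3
    linear_combination h0 + 3 * t ^ 2 * hy

end LinesOverPoints

section Chords

variable {L : Type*} [Field L] {e θ : Fin 6 → L} {v w : Fin 4 → L} {i j : Fin 6}

/-- The line of the cubic surface that is the image of the line through the points `cuspPoint s`
and `cuspPoint t`. -/
def chordLine (e : Fin 6 → L) (s t : L) : Submodule L (Fin 4 → L) :=
  Submodule.span L {cubicDeriv e (cuspPoint s) (cuspPoint t),
    cubicDeriv e (cuspPoint t) (cuspPoint s)}

theorem linearIndependent_cuspPoint {s t : L} (h : s ≠ t) :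
    LinearIndependent L ![cuspPoint s, cuspPoint t] :=
  (LinearIndependent.pair_iff' (cuspPoint_ne_zero s)).mpr fun _ ha =>
    h (eq_of_cuspPoint_eq_smul ha.symm).symm

theorem eq_zero_of_smul_cuspPoint_add_eq_smul (h : GeneralSextic e θ) {k : Fin 6}
    (hij : i ≠ j) (hik : i ≠ k) (hjk : j ≠ k) {a b c : L}
    (habc : a • cuspPoint (θ i) + b • cuspPoint (θ j) = c • cuspPoint (θ k)) :
    a = 0 ∧ b = 0 := by
  have h0 : a * 1 + b * 1 = c * 1 := congrFun habc 0
  have h1 : a * θ i + b * θ j = c * θ k := congrFun habc 1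
  have h2 : a * θ i ^ 3 + b * θ j ^ 3 = c * θ k ^ 3 := congrFun habc 2
  have hki : θ i - θ k ≠ 0 := sub_ne_zero.mpr (h.injective.ne hik)
  have hkj : θ j - θ k ≠ 0 := sub_ne_zero.mpr (h.injective.ne hjk)
  have hji : θ j - θ i ≠ 0 := sub_ne_zero.mpr (h.injective.ne hij.symm)
  have hb : (θ j - θ k) * (θ j - θ i) * (θ i + θ j + θ k) * b = 0 := by
    linear_combination (h2 - θ k ^ 3 * h0) - (θ i ^ 2 + θ i * θ k + θ k ^ 2) * (h1 - θ k * h0)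
  have hb : b = 0 := (mul_eq_zero.mp hb).resolve_left
    (mul_ne_zero (mul_ne_zero hkj hji) (h.add_add_ne_zero i j k hij hjk hik))
  have ha : (θ i - θ k) * a = 0 := by
    linear_combination h1 - θ k * h0 - (θ j - θ k) * hb
  exact ⟨(mul_eq_zero.mp ha).resolve_left hki, hb⟩

theorem cubicMap_cuspPoint_add_cuspPoint_ne_zero (h : GeneralSextic e θ) (hij : i ≠ j) :
    cubicMap e (cuspPoint (θ i) + cuspPoint (θ j)) ≠ 0 := by
  intro hc
  have hli := linearIndependent_cuspPoint (h.injective.ne hij)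
  rw [LinearIndependent.pair_iff] at hli
  have hsum : cuspPoint (θ i) + cuspPoint (θ j) ≠ 0 := fun h0 =>
    one_ne_zero (hli 1 1 (by rwa [one_smul, one_smul])).1
  obtain ⟨k, c, -, hk⟩ := exists_eq_smul_cuspPoint h hsum hc
  rcases eq_or_ne i k with rfl | hik
  · exact one_ne_zero (hli (1 - c) 1 (by rw [sub_smul, ← hk]; module)).2
  rcases eq_or_ne j k with rfl | hjk
  · exact one_ne_zero (hli 1 (1 - c) (by rw [sub_smul, ← hk]; module)).1
  exact one_ne_zero (eq_zero_of_smul_cuspPoint_add_eq_smul h hij hik hjk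
    (by rw [one_smul, one_smul, hk])).1

theorem cubicDeriv_cuspPoint_ne_zero (h : GeneralSextic e θ) (hij : i ≠ j) :
    cubicDeriv e (cuspPoint (θ i)) (cuspPoint (θ j)) ≠ 0 := fun h0 =>
  hij.symm (h.injective (eq_of_cuspPoint_eq_smul (eq_smul_of_cubicDeriv_eq_zero h i h0)))

theorem chordLine_comm (e : Fin 6 → L) (s t : L) : chordLine e s t = chordLine e t s := by
  rw [chordLine, Set.pair_comm, chordLine]

theorem syzMatrix_add_smul_mulVec_add_smul {v₁ v₂ : Fin 4 → L} {u₁ u₂ : Fin 3 → L}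
    (h₁ : syzMatrix e v₁ *ᵥ u₁ = 0) (h₂ : syzMatrix e v₂ *ᵥ u₂ = 0)
    (h₁₂ : syzMatrix e v₁ *ᵥ u₂ + syzMatrix e v₂ *ᵥ u₁ = 0) (q s q' s' : L) :
    syzMatrix e (q • v₁ + s • v₂) *ᵥ (q' • u₁ + s' • u₂) =
      (q * s' - s * q') • (syzMatrix e v₁ *ᵥ u₂) := by
  simp only [map_add, map_smul, Matrix.add_mulVec, Matrix.mulVec_add, Matrix.smul_mulVec,
    Matrix.mulVec_smul, h₁, h₂, eq_neg_of_add_eq_zero_right h₁₂]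
  module

theorem syzMatrix_chord_mulVec (h : GeneralSextic e θ) (i j : Fin 6) (a b : L) :
    syzMatrix e (a • cubicDeriv e (cuspPoint (θ i)) (cuspPoint (θ j))
        + b • cubicDeriv e (cuspPoint (θ j)) (cuspPoint (θ i))) *ᵥ
      (a • cuspPoint (θ i) + b • cuspPoint (θ j)) = 0 := by
  rw [syzMatrix_add_smul_mulVec_add_smul
    (mem_exceptionalLine.mp (cubicDeriv_mem_exceptionalLine h i _))
    (mem_exceptionalLine.mp (cubicDeriv_mem_exceptionalLine h j _))
    (syzMatrix_cubicDeriv_add e _ _), mul_comm, sub_self, zero_smul]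

variable [IsAlgClosed L]

theorem disjoint_exceptionalLine (h : GeneralSextic e θ) (hij : i ≠ j) :
    Disjoint (exceptionalLine e (θ i)) (exceptionalLine e (θ j)) :=
  Submodule.disjoint_def.mpr fun _ hi hj =>
    eq_zero_of_linearIndependent_of_mulVec_eq_zero h
      (linearIndependent_cuspPoint (h.injective.ne hij)) (mem_exceptionalLine.mp hi)
      (mem_exceptionalLine.mp hj)

theorem linearIndependent_cubicDeriv_cuspPoint (h : GeneralSextic e θ) (hij : i ≠ j) :
    LinearIndependent L ![cubicDeriv e (cuspPoint (θ i)) (cuspPoint (θ j)),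
      cubicDeriv e (cuspPoint (θ j)) (cuspPoint (θ i))] :=
  (LinearIndependent.pair_iff' (cubicDeriv_cuspPoint_ne_zero h hij)).mpr fun a ha =>
    cubicDeriv_cuspPoint_ne_zero h hij.symm <|
      Submodule.disjoint_def.mp (disjoint_exceptionalLine h hij) _
        (ha ▸ Submodule.smul_mem _ a (cubicDeriv_mem_exceptionalLine h i _))
        (cubicDeriv_mem_exceptionalLine h j _)

theorem finrank_chordLine (h : GeneralSextic e θ) (hij : i ≠ j) :
    Module.finrank L (chordLine e (θ i) (θ j)) = 2 := by
  rw [chordLine, ← Matrix.range_cons_cons_empty _ _ ![],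
    finrank_span_eq_card (linearIndependent_cubicDeriv_cuspPoint h hij), Fintype.card_fin]

theorem exists_eq_smul_cubicDeriv (h : GeneralSextic e θ) (hij : i ≠ j)
    (hv : v ∈ exceptionalLine e (θ i)) (hw : w ∈ exceptionalLine e (θ j))
    (hvw : syzMatrix e v *ᵥ cuspPoint (θ j) + syzMatrix e w *ᵥ cuspPoint (θ i) = 0) :
    ∃ c : L, v = c • cubicDeriv e (cuspPoint (θ i)) (cuspPoint (θ j)) ∧
      w = c • cubicDeriv e (cuspPoint (θ j)) (cuspPoint (θ i)) := by
  have hsum : syzMatrix e (v + w) *ᵥ (cuspPoint (θ i) + cuspPoint (θ j)) = 0 := by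
    have := syzMatrix_add_smul_mulVec_add_smul (mem_exceptionalLine.mp hv)
      (mem_exceptionalLine.mp hw) hvw 1 1 1 1
    rwa [sub_self, zero_smul, one_smul, one_smul, one_smul, one_smul] at this
  obtain ⟨c, hc⟩ := eq_smul_cubicMap h.coeff_ne_zero
    (cubicMap_cuspPoint_add_cuspPoint_ne_zero h hij) hsum
  have hexp := cubicMap_add_smul e 1 (cuspPoint (θ i)) (cuspPoint (θ j))
  simp only [one_pow, one_smul, cubicMap_cuspPoint_eq_zero h, zero_add, add_zero] at hexp
  rw [hexp, smul_add] at hc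
  have hdiff : v - c • cubicDeriv e (cuspPoint (θ i)) (cuspPoint (θ j)) =
      c • cubicDeriv e (cuspPoint (θ j)) (cuspPoint (θ i)) - w := by
    rw [sub_eq_sub_iff_add_eq_add, hc, add_comm]
  have hzero : v - c • cubicDeriv e (cuspPoint (θ i)) (cuspPoint (θ j)) = 0 :=
    Submodule.disjoint_def.mp (disjoint_exceptionalLine h hij) _
      (sub_mem hv (Submodule.smul_mem _ c (cubicDeriv_mem_exceptionalLine h i _)))
      (hdiff ▸ sub_mem (Submodule.smul_mem _ c (cubicDeriv_mem_exceptionalLine h j _)) hw)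
  exact ⟨c, sub_eq_zero.mp hzero, (sub_eq_zero.mp (hdiff.symm.trans hzero)).symm⟩

end Chords

section LinesOnSurface

variable {L : Type*} [Field L] {e θ : Fin 6 → L} {a b : Fin 3 → L} {v w : Fin 4 → L}
  {W : Submodule L (Fin 4 → L)} {i j : Fin 6}

theorem cubicMap_combination (e : Fin 6 → L) (q s : L) (a b : Fin 3 → L) :
    cubicMap e (q • a + s • b) = q ^ 3 • cubicMap e a + (q ^ 2 * s) • cubicDeriv e a b
      + (q * s ^ 2) • cubicDeriv e b a + s ^ 3 • cubicMap e b := by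
  rw [cubicMap_add_smul, cubicMap_smul, cubicDeriv_smul_left, cubicDeriv_smul_right]
  module

theorem cubicDeriv_combination_left (e : Fin 6 → L) (q s : L) (a b : Fin 3 → L) :
    cubicDeriv e (q • a + s • b) a = (3 * q ^ 2) • cubicMap e a + (2 * q * s) • cubicDeriv e a b
      + s ^ 2 • cubicDeriv e b a := by
  ext j
  fin_cases j <;> simp [cubicMap, cubicDeriv] <;> ring

theorem exists_cubicMap_eq_smul (h0 : e 0 ≠ 0) (hli : LinearIndependent L ![v, w])
    (ha : syzMatrix e v *ᵥ a = 0) (hb : syzMatrix e w *ᵥ b = 0)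
    (hab : syzMatrix e v *ᵥ b + syzMatrix e w *ᵥ a = 0) (s : L) :
    ∃ c : L, cubicMap e (a + s • b) = c • (v + s • w) := by
  by_cases hc : cubicMap e (a + s • b) = 0
  · exact ⟨0, by rw [hc, zero_smul]⟩
  have hs : syzMatrix e (v + s • w) *ᵥ (a + s • b) = 0 := by
    have := syzMatrix_add_smul_mulVec_add_smul ha hb hab 1 s 1 s
    rwa [one_mul, mul_one, sub_self, zero_smul, one_smul, one_smul] at this
  obtain ⟨c, hcv⟩ := eq_smul_cubicMap h0 hc hs
  have hc0 : c ≠ 0 := by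
    rintro rfl
    rw [zero_smul] at hcv
    exact one_ne_zero (LinearIndependent.pair_iff.mp hli 1 s (by rwa [one_smul])).1
  exact ⟨c⁻¹, by rw [hcv, inv_smul_smul₀ hc0]⟩

/- A linear form equal to `1` at `v` and `0` at `w` reads off the factor in
`exists_cubicMap_eq_smul` as a polynomial in `s`; comparing coefficients of powers of `s` shows that
its degree is at most two. -/
theorem exists_quadratic_factor [Infinite L] (h0 : e 0 ≠ 0) (hli : LinearIndependent L ![v, w])
    (ha : syzMatrix e v *ᵥ a = 0) (hb : syzMatrix e w *ᵥ b = 0)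
    (hab : syzMatrix e v *ᵥ b + syzMatrix e w *ᵥ a = 0) :
    ∃ k₀ k₁ k₂ : L, cubicMap e a = k₀ • v ∧ cubicDeriv e a b = k₁ • v + k₀ • w ∧
      cubicDeriv e b a = k₂ • v + k₁ • w ∧ cubicMap e b = k₂ • w := by
  obtain ⟨φ, hφv, hφw⟩ : ∃ φ : (Fin 4 → L) →ₗ[L] L, φ v = 1 ∧ φ w = 0 := by
    obtain ⟨g, hg⟩ := LinearMap.exists_leftInverse_of_injective _
      (LinearMap.ker_eq_bot.mpr (linearIndependent_iff_injective_fintypeLinearCombination.mp hli))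
    have hgs (x y : L) : g (x • v + y • w) = ![x, y] := by
      simpa [Fintype.linearCombination_apply] using LinearMap.congr_fun hg ![x, y]
    exact ⟨LinearMap.proj 0 ∘ₗ g, by simpa using congrFun (hgs 1 0) 0,
      by simpa using congrFun (hgs 0 1) 0⟩
  have hfac (s : L) : cubicMap e (a + s • b) = φ (cubicMap e (a + s • b)) • (v + s • w) := by
    obtain ⟨c, hc⟩ := exists_cubicMap_eq_smul h0 hli ha hb hab s
    rw [hc, map_smul, map_add, map_smul, hφv, hφw, smul_zero, add_zero, smul_eq_mul, mul_one]
  have hcoef (j : Fin 4) : ![cubicMap e a j - φ (cubicMap e a) * v j,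
      cubicDeriv e a b j - φ (cubicDeriv e a b) * v j - φ (cubicMap e a) * w j,
      cubicDeriv e b a j - φ (cubicDeriv e b a) * v j - φ (cubicDeriv e a b) * w j,
      cubicMap e b j - φ (cubicMap e b) * v j - φ (cubicDeriv e b a) * w j,
      -(φ (cubicMap e b) * w j)] = 0 := by
    refine eq_zero_of_forall_sum_pow_mul_eq_zero fun s => ?_
    have hs := congrFun (hfac s) j
    rw [cubicMap_add_smul] at hs
    simp only [map_add, map_smul, Pi.add_apply, Pi.smul_apply, smul_eq_mul] at hs
    simp only [Fin.sum_univ_five, Fin.isValue, Fin.coe_ofNat_eq_mod, Matrix.cons_val]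
    linear_combination hs
  simp only [Matrix.cons_eq_zero_iff] at hcoef
  have hφb : φ (cubicMap e b) = 0 := by
    have hw : φ (cubicMap e b) • w = 0 := funext fun j => neg_eq_zero.mp (hcoef j).2.2.2.2.1
    exact (smul_eq_zero.mp hw).resolve_right (hli.ne_zero 1)
  refine ⟨φ (cubicMap e a), φ (cubicDeriv e a b), φ (cubicDeriv e b a), ?_, ?_, ?_, ?_⟩ <;>
    ext j <;> simp only [Pi.add_apply, Pi.smul_apply, smul_eq_mul]
  · linear_combination (hcoef j).1
  · linear_combination (hcoef j).2.1
  · linear_combination (hcoef j).2.2.1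
  · linear_combination (hcoef j).2.2.2.1 + v j * hφb

theorem exists_combination_eq_cuspPoint (h : GeneralSextic e θ)
    (hli : LinearIndependent L ![a, b]) {k₀ k₁ k₂ : L}
    (hfac : ∀ q s : L, cubicMap e (q • a + s • b) =
      (k₀ * q ^ 2 + k₁ * q * s + k₂ * s ^ 2) • (q • v + s • w)) {q s : L} (hqs : q ≠ 0 ∨ s ≠ 0)
    (hz : k₀ * q ^ 2 + k₁ * q * s + k₂ * s ^ 2 = 0) :
    ∃ i, ∃ c : L, c ≠ 0 ∧ (c * q) • a + (c * s) • b = cuspPoint (θ i) := by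
  have hu : q • a + s • b ≠ 0 := fun hu =>
    have hzero := LinearIndependent.pair_iff.mp hli q s hu
    hqs.elim (· hzero.1) (· hzero.2)
  obtain ⟨i, c, hc, hi⟩ := exists_eq_smul_cuspPoint h hu (by rw [hfac, hz, zero_smul])
  refine ⟨i, c⁻¹, inv_ne_zero hc, ?_⟩
  rw [mul_smul, mul_smul, ← smul_add, hi, inv_smul_smul₀ hc]

/- A double zero of the quadratic factor would make the differential of the cubics vanish on the
whole plane spanned by `a` and `b`, but its kernel at a base point is one-dimensional. -/
theorem exists_pair_of_base_points [IsAlgClosed L] (h : GeneralSextic e θ)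
    (hab : LinearIndependent L ![a, b]) (hvw : LinearIndependent L ![v, w])
    (ha : syzMatrix e v *ᵥ a = 0) (hb : syzMatrix e w *ᵥ b = 0)
    (hsum : syzMatrix e v *ᵥ b + syzMatrix e w *ᵥ a = 0) :
    ∃ i j, ∃ q₁ s₁ q₂ s₂ : L, q₁ * s₂ - q₂ * s₁ ≠ 0 ∧ q₁ • a + s₁ • b = cuspPoint (θ i) ∧
      q₂ • a + s₂ • b = cuspPoint (θ j) := by
  obtain ⟨k₀, k₁, k₂, f₀, f₁, f₂, f₃⟩ := exists_quadratic_factor h.coeff_ne_zero hvw ha hb hsum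
  have hfac (q s : L) : cubicMap e (q • a + s • b) =
      (k₀ * q ^ 2 + k₁ * q * s + k₂ * s ^ 2) • (q • v + s • w) := by
    rw [cubicMap_combination, f₀, f₁, f₂, f₃]
    module
  rcases exists_zeros_of_binary_quadratic k₀ k₁ k₂ with
    ⟨q₁, s₁, q₂, s₂, hne, hz₁, hz₂⟩ | ⟨q, s, hqs, hz, hq, hs⟩
  · obtain ⟨i, c, hc, hi⟩ := exists_combination_eq_cuspPoint h hab hfac (q := q₁) (s := s₁)
      (by by_contra! h0; simp [h0.1, h0.2] at hne) hz₁
    obtain ⟨j, d, hd, hj⟩ := exists_combination_eq_cuspPoint h hab hfac (q := q₂) (s := s₂)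
      (by by_contra! h0; simp [h0.1, h0.2] at hne) hz₂
    refine ⟨i, j, _, _, _, _, ?_, hi, hj⟩
    convert mul_ne_zero (mul_ne_zero hc hd) hne using 1
    ring
  · exfalso
    obtain ⟨i, c, -, hi⟩ := exists_combination_eq_cuspPoint h hab hfac hqs hz
    have hda : cubicDeriv e (cuspPoint (θ i)) a = 0 := by
      rw [← hi, cubicDeriv_combination_left, f₀, f₁, f₂]
      linear_combination (norm := module) (c ^ 2 * hz) • v + (c ^ 2 * hq) • (q • v + s • w)
    have hdb : cubicDeriv e (cuspPoint (θ i)) b = 0 := by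
      rw [← hi, add_comm, cubicDeriv_combination_left, f₁, f₂, f₃]
      linear_combination (norm := module) (c ^ 2 * hz) • w + (c ^ 2 * hs) • (q • v + s • w)
    have hzero := LinearIndependent.pair_iff.mp hab (b 0) (-a 0) (by
      linear_combination (norm := module)
        b 0 • eq_smul_of_cubicDeriv_eq_zero h i hda - a 0 • eq_smul_of_cubicDeriv_eq_zero h i hdb)
    exact hab.ne_zero 1 ((eq_smul_of_cubicDeriv_eq_zero h i hdb).trans (by rw [hzero.1, zero_smul]))

/-- A line of projective three-space, given as a two-dimensional linear subspace, that is contained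
in the cubic surface where the determinant of `syzMatrix e` vanishes. -/
def IsSurfaceLine (e : Fin 6 → L) (W : Submodule L (Fin 4 → L)) : Prop :=
  Module.finrank L W = 2 ∧ ∀ v ∈ W, (syzMatrix e v).det = 0

theorem isSurfaceLine_exceptionalLine (h : GeneralSextic e θ) (i : Fin 6) :
    IsSurfaceLine e (exceptionalLine e (θ i)) :=
  ⟨finrank_exceptionalLine h i, fun _ hv => Matrix.exists_mulVec_eq_zero_iff.mp
    ⟨_, cuspPoint_ne_zero _, mem_exceptionalLine.mp hv⟩⟩

theorem isSurfaceLine_conicLine (h : GeneralSextic e θ) (i : Fin 6) :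
    IsSurfaceLine e (conicLine e (θ i)) :=
  ⟨finrank_conicLine h i, fun _ hv => Matrix.exists_vecMul_eq_zero_iff.mp
    ⟨_, leftPoint_ne_zero e _, mem_conicLine.mp hv⟩⟩

theorem isSurfaceLine_chordLine [IsAlgClosed L] (h : GeneralSextic e θ) (hij : i ≠ j) :
    IsSurfaceLine e (chordLine e (θ i) (θ j)) := by
  refine ⟨finrank_chordLine h hij, fun v hv => ?_⟩
  obtain ⟨a, b, rfl⟩ := Submodule.mem_span_pair.mp hv
  by_cases hab : a • cuspPoint (θ i) + b • cuspPoint (θ j) = 0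
  · have hli := linearIndependent_cuspPoint (h.injective.ne hij)
    obtain ⟨rfl, rfl⟩ := LinearIndependent.pair_iff.mp hli a b hab
    rw [zero_smul, zero_smul, add_zero, map_zero, Matrix.det_zero]
  · exact Matrix.exists_mulVec_eq_zero_iff.mp ⟨_, hab, syzMatrix_chord_mulVec h i j a b⟩

theorem IsSurfaceLine.exists_eq_span (hW : IsSurfaceLine e W) :
    ∃ v w, LinearIndependent L ![v, w] ∧ W = Submodule.span L {v, w} := by
  let B := Module.finBasisOfFinrankEq L W hW.1
  have hB : W.subtype ∘ B = ![(B 0 : Fin 4 → L), (B 1 : Fin 4 → L)] := by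
    ext i : 1
    fin_cases i <;> rfl
  refine ⟨B 0, B 1, ?_, ?_⟩
  · rw [← hB]
    exact B.linearIndependent.map' _ W.ker_subtype
  · rw [← Matrix.range_cons_cons_empty _ _ ![], ← hB, Set.range_comp, Submodule.span_image,
      B.span_eq, Submodule.map_top, Submodule.range_subtype]

theorem exists_eq_exceptionalLine [IsAlgClosed L] (h : GeneralSextic e θ)
    (hW : IsSurfaceLine e W) {u : Fin 3 → L} (hu : u ≠ 0)
    (hWu : ∀ v ∈ W, syzMatrix e v *ᵥ u = 0) : ∃ i, W = exceptionalLine e (θ i) := by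
  have hc : cubicMap e u = 0 := by
    by_contra hc
    have hle : W ≤ Submodule.span L {cubicMap e u} := fun v hv =>
      have ⟨c, hcv⟩ := eq_smul_cubicMap h.coeff_ne_zero hc (hWu v hv)
      Submodule.mem_span_singleton.mpr ⟨c, hcv.symm⟩
    have := Submodule.finrank_mono hle
    rw [hW.1, finrank_span_singleton hc] at this
    omega
  obtain ⟨i, a, ha, rfl⟩ := exists_eq_smul_cuspPoint h hu hc
  refine ⟨i, Submodule.eq_of_le_of_finrank_eq (fun v hv => mem_exceptionalLine.mpr ?_)
    (hW.1.trans (finrank_exceptionalLine h i).symm)⟩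
  have := hWu v hv
  rwa [Matrix.mulVec_smul, smul_eq_zero_iff_right ha] at this

theorem exists_eq_chordLine [IsAlgClosed L] (h : GeneralSextic e θ) (hW : IsSurfaceLine e W)
    (hv : v ∈ W) (hw : w ∈ W) (hvw : LinearIndependent L ![v, w])
    (hab : LinearIndependent L ![a, b]) (ha : syzMatrix e v *ᵥ a = 0)
    (hb : syzMatrix e w *ᵥ b = 0) (hsum : syzMatrix e v *ᵥ b + syzMatrix e w *ᵥ a = 0) :
    ∃ i j, i ≠ j ∧ W = chordLine e (θ i) (θ j) := by
  obtain ⟨i, j, q₁, s₁, q₂, s₂, hne, hi, hj⟩ := exists_pair_of_base_points h hab hvw ha hb hsum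
  have hmul := syzMatrix_add_smul_mulVec_add_smul ha hb hsum
  have hij : i ≠ j := by
    rintro rfl
    obtain ⟨hq, hs⟩ := LinearIndependent.pair_iff.mp hab (q₁ - q₂) (s₁ - s₂)
      (by linear_combination (norm := module) hi - hj)
    exact hne (by linear_combination s₂ * hq - q₂ * hs)
  obtain ⟨c, hc₁, hc₂⟩ := exists_eq_smul_cubicDeriv h hij
    (v := q₁ • v + s₁ • w) (w := q₂ • v + s₂ • w)
    (by rw [mem_exceptionalLine, ← hi, hmul, mul_comm, sub_self, zero_smul])
    (by rw [mem_exceptionalLine, ← hj, hmul, mul_comm, sub_self, zero_smul])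
    (by rw [← hi, ← hj, hmul, hmul]; module)
  have hc : c ≠ 0 := by
    rintro rfl
    rw [zero_smul] at hc₁
    obtain ⟨rfl, rfl⟩ := LinearIndependent.pair_iff.mp hvw q₁ s₁ hc₁
    simp at hne
  refine ⟨i, j, hij, (Submodule.eq_of_le_of_finrank_eq ?_ ?_).symm⟩
  · have hmem (q s : L) : q • v + s • w ∈ W := add_mem (W.smul_mem q hv) (W.smul_mem s hw)
    rw [chordLine, Submodule.span_le, Set.pair_subset_iff]
    exact ⟨(W.smul_mem_iff hc).mp (hc₁ ▸ hmem q₁ s₁), (W.smul_mem_iff hc).mp (hc₂ ▸ hmem q₂ s₂)⟩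
  · rw [hW.1, finrank_chordLine h hij]

/- The vectors `x ᵥ* syzMatrix e v` only depend on `v` modulo `W`, so they are all orthogonal to
some `u ≠ 0`; this `u` is a base point, and it determines `x`. -/
theorem exists_eq_conicLine (h : GeneralSextic e θ) (hW : IsSurfaceLine e W) {x : Fin 3 → L}
    (hx : x ≠ 0) (hWx : ∀ v ∈ W, x ᵥ* syzMatrix e v = 0) : ∃ i, W = conicLine e (θ i) := by
  let f : (Fin 4 → L) →ₗ[L] Fin 3 → L := Matrix.vecMulBilin L L x ∘ₗ syzMatrix e
  have hrange : LinearMap.range f < ⊤ := by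
    refine lt_top_iff_ne_top.mpr fun htop => ?_
    have hker := Submodule.finrank_mono (show W ≤ LinearMap.ker f from hWx)
    have hrank := f.finrank_range_add_finrank_ker
    rw [htop, finrank_top, Module.finrank_fin_fun, Module.finrank_fin_fun] at hrank
    rw [hW.1] at hker
    omega
  obtain ⟨φ, hφ, hle⟩ := Submodule.exists_le_ker_of_lt_top _ hrange
  obtain ⟨u, rfl⟩ := (dotProductEquiv L (Fin 3)).surjective φ
  have hu : u ≠ 0 := by
    rintro rfl
    exact hφ (map_zero _)
  have hxu (v : Fin 4 → L) : x ⬝ᵥ (syzMatrix e v *ᵥ u) = 0 := by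
    rw [Matrix.dotProduct_mulVec, dotProduct_comm]
    exact hle ⟨v, rfl⟩
  obtain ⟨i, c, hc, rfl⟩ := exists_eq_smul_cuspPoint h hu
    (cubicMap_eq_zero_of_forall_dotProduct h.coeff_ne_zero hx hxu)
  have hxi := eq_smul_leftPoint (w := x) fun v => by
    have := hxu v
    rwa [Matrix.mulVec_smul, dotProduct_smul, smul_eq_zero_iff_right hc] at this
  have hx2 : x 2 ≠ 0 := fun h2 => hx (by rw [hxi, h2, zero_smul])
  refine ⟨i, Submodule.eq_of_le_of_finrank_eq (fun v hv => mem_conicLine.mpr ?_)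
    (hW.1.trans (finrank_conicLine h i).symm)⟩
  have := hWx v hv
  rwa [hxi, Matrix.smul_vecMul, smul_eq_zero_iff_right hx2] at this

theorem IsSurfaceLine.trichotomy [IsAlgClosed L] (h : GeneralSextic e θ)
    (hW : IsSurfaceLine e W) :
    (∃ i, W = exceptionalLine e (θ i)) ∨ (∃ i j, i ≠ j ∧ W = chordLine e (θ i) (θ j)) ∨
      ∃ i, W = conicLine e (θ i) := by
  obtain ⟨v, w, hvw, hspan⟩ := hW.exists_eq_span
  have hv : v ∈ W := hspan ▸ Submodule.subset_span (Set.mem_insert v {w})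
  have hw : w ∈ W := hspan ▸ Submodule.subset_span (Set.mem_insert_of_mem v rfl)
  have hdet (s : L) : (syzMatrix e v + s • syzMatrix e w).det = 0 := by
    rw [← map_smul, ← map_add]
    exact hW.2 _ (add_mem hv (W.smul_mem s hw))
  have hadj : (syzMatrix e w).adjugate ≠ 0 := fun h0 =>
    hvw.ne_zero 1 (eq_zero_of_adjugate_eq_zero h h0)
  rcases singular_pencil_trichotomy hdet hadj with
    ⟨u, hu, huv, huw⟩ | ⟨a, b, hab, ha, hsum, hb⟩ | ⟨x, hx, hxv, hxw⟩
  · refine Or.inl (exists_eq_exceptionalLine h hW hu fun y hy => ?_)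
    obtain ⟨q, s, rfl⟩ := Submodule.mem_span_pair.mp (hspan ▸ hy)
    simp only [map_add, map_smul, Matrix.add_mulVec, Matrix.smul_mulVec, huv, huw, smul_zero,
      add_zero]
  · exact Or.inr (Or.inl (exists_eq_chordLine h hW hv hw hvw hab ha hb hsum))
  · refine Or.inr (Or.inr (exists_eq_conicLine h hW hx fun y hy => ?_))
    obtain ⟨q, s, rfl⟩ := Submodule.mem_span_pair.mp (hspan ▸ hy)
    simp only [map_add, map_smul, Matrix.vecMul_add, Matrix.vecMul_smul, hxv, hxw, smul_zero,
      add_zero]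

end LinesOnSurface

section Incidence

variable {L : Type*} [Field L] {e θ : Fin 6 → L} {W : Submodule L (Fin 4 → L)} {i j : Fin 6}

/-- The indices of those of the six exceptional lines which meet the line `W`. They determine `W`
among the lines of the cubic surface. -/
def incidence (e θ : Fin 6 → L) (W : Submodule L (Fin 4 → L)) : Set (Fin 6) :=
  {i | ∃ v ∈ W, v ≠ 0 ∧ v ∈ exceptionalLine e (θ i)}

theorem mem_incidence_iff_not_disjoint :
    i ∈ incidence e θ W ↔ ¬ Disjoint W (exceptionalLine e (θ i)) := by
  rw [Submodule.disjoint_def]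
  push Not
  exact exists_congr fun v => and_congr_right fun _ => and_comm

theorem leftPoint_vecMul_syzMatrix_dotProduct_cuspPoint (h : GeneralSextic e θ) (i : Fin 6)
    (v : Fin 4 → L) : (leftPoint e (θ i) ᵥ* syzMatrix e v) ⬝ᵥ cuspPoint (θ i) = 0 := by
  have hP := h.sextic_eq_zero i
  rw [sextic] at hP
  simp only [leftPoint_vecMul_syzMatrix, cuspPoint, dotProduct, Fin.sum_univ_three,
    Matrix.cons_val]
  linear_combination e 0 * v 0 * hP

/- For `v` on the exceptional line `i`, the vector `leftPoint e (θ k) ᵥ* syzMatrix e v` is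
orthogonal to two distinct points of the cuspidal cubic, so that its vanishing is a single linear
condition. -/
theorem not_disjoint_conicLine_exceptionalLine (h : GeneralSextic e θ) {k : Fin 6} (hik : i ≠ k) :
    ¬ Disjoint (conicLine e (θ k)) (exceptionalLine e (θ i)) := by
  let f : exceptionalLine e (θ i) →ₗ[L] L :=
    LinearMap.proj 2 ∘ₗ Matrix.vecMulBilin L L (leftPoint e (θ k)) ∘ₗ syzMatrix e ∘ₗ
      (exceptionalLine e (θ i)).subtype
  have hker : LinearMap.ker f ≠ ⊥ := LinearMap.ker_ne_bot_of_finrank_lt (by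
    rw [Module.finrank_self, finrank_exceptionalLine h]
    exact one_lt_two)
  obtain ⟨⟨v, hv⟩, hfv, hv0⟩ := Submodule.exists_mem_ne_zero_of_ne_bot hker
  rw [Submodule.disjoint_def]
  refine fun hdisj => hv0 (Subtype.ext (hdisj v ?_ hv))
  set r := leftPoint e (θ k) ᵥ* syzMatrix e v with hr
  have hr2 : r 2 = 0 := hfv
  have hrk : r ⬝ᵥ cuspPoint (θ k) = 0 := leftPoint_vecMul_syzMatrix_dotProduct_cuspPoint h k v
  have hri : r ⬝ᵥ cuspPoint (θ i) = 0 := by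
    rw [hr, ← Matrix.dotProduct_mulVec, mem_exceptionalLine.mp hv, dotProduct_zero]
  simp only [cuspPoint, dotProduct, Fin.sum_univ_three, Matrix.cons_val, hr2] at hrk hri
  have hne : θ i - θ k ≠ 0 := sub_ne_zero.mpr (h.injective.ne hik)
  have hr1 : r 1 = 0 := (mul_eq_zero.mp (by linear_combination hri - hrk :
    (θ i - θ k) * r 1 = 0)).resolve_left hne
  rw [mem_conicLine, ← hr]
  ext j
  fin_cases j
  exacts [by linear_combination (norm := (simp; ring)) hri - θ i * hr1, hr1, hr2]

theorem incidence_conicLine (h : GeneralSextic e θ) (k : Fin 6) :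
    incidence e θ (conicLine e (θ k)) = {k}ᶜ := by
  ext i
  rw [mem_incidence_iff_not_disjoint, Set.mem_compl_singleton_iff]
  refine ⟨?_, not_disjoint_conicLine_exceptionalLine h⟩
  rintro hi rfl
  exact hi (disjoint_exceptionalLine_conicLine h i).symm

variable [IsAlgClosed L]

theorem incidence_exceptionalLine (h : GeneralSextic e θ) (i : Fin 6) :
    incidence e θ (exceptionalLine e (θ i)) = {i} := by
  ext j
  rw [mem_incidence_iff_not_disjoint, Set.mem_singleton_iff]
  refine ⟨fun hj => ?_, ?_⟩
  · by_contra hij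
    exact hj (disjoint_exceptionalLine h (Ne.symm hij))
  · rintro rfl hdisj
    have := finrank_exceptionalLine h j
    rw [disjoint_self.mp hdisj, finrank_bot] at this
    omega

theorem incidence_chordLine (h : GeneralSextic e θ) (hij : i ≠ j) :
    incidence e θ (chordLine e (θ i) (θ j)) = {i, j} := by
  ext k
  constructor
  · rintro ⟨x, hx, hx0, hk⟩
    obtain ⟨a, b, rfl⟩ := Submodule.mem_span_pair.mp hx
    by_contra! hne
    obtain ⟨hki, hkj⟩ : k ≠ i ∧ k ≠ j := by simpa using hne
    obtain ⟨c, hc⟩ := eq_smul_of_mulVec_eq_zero h hx0 (cuspPoint_ne_zero _)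
      (mem_exceptionalLine.mp hk) (syzMatrix_chord_mulVec h i j a b)
    obtain ⟨rfl, rfl⟩ := eq_zero_of_smul_cuspPoint_add_eq_smul h hij hki.symm hkj.symm hc
    exact hx0 (by rw [zero_smul, zero_smul, add_zero])
  · rintro (rfl | rfl)
    · exact ⟨_, Submodule.subset_span (Set.mem_insert _ _), cubicDeriv_cuspPoint_ne_zero h hij,
        cubicDeriv_mem_exceptionalLine h _ _⟩
    · exact ⟨_, Submodule.subset_span (Set.mem_insert_of_mem _ rfl),
        cubicDeriv_cuspPoint_ne_zero h hij.symm, cubicDeriv_mem_exceptionalLine h _ _⟩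

theorem IsSurfaceLine.incidence_trichotomy (h : GeneralSextic e θ) (hW : IsSurfaceLine e W) :
    ((incidence e θ W).ncard = 1 ∧ ∃ i, W = exceptionalLine e (θ i) ∧ incidence e θ W = {i}) ∨
    ((incidence e θ W).ncard = 2 ∧
      ∃ i j, W = chordLine e (θ i) (θ j) ∧ incidence e θ W = {i, j}) ∨
    ((incidence e θ W).ncard = 5 ∧ ∃ i, W = conicLine e (θ i) ∧ incidence e θ W = {i}ᶜ) := by
  rcases hW.trichotomy h with ⟨i, rfl⟩ | ⟨i, j, hij, rfl⟩ | ⟨i, rfl⟩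
  · have hI := incidence_exceptionalLine h i
    exact Or.inl ⟨by rw [hI, Set.ncard_singleton], i, rfl, hI⟩
  · have hI := incidence_chordLine h hij
    exact Or.inr (Or.inl ⟨by rw [hI, Set.ncard_pair hij], i, j, rfl, hI⟩)
  · have hI := incidence_conicLine h i
    exact Or.inr (Or.inr ⟨by rw [hI, Set.ncard_compl, Set.ncard_singleton, Nat.card_fin],
      i, rfl, hI⟩)

theorem incidence_injOn (h : GeneralSextic e θ) :
    Set.InjOn (incidence e θ) {W | IsSurfaceLine e W} := by
  intro W hW W' hW' heq
  have hcard := congrArg Set.ncard heq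
  rcases IsSurfaceLine.incidence_trichotomy h hW with
    ⟨hn, i, hWi, hI⟩ | ⟨hn, i, j, hWij, hI⟩ | ⟨hn, i, hWi, hI⟩ <;>
  rcases IsSurfaceLine.incidence_trichotomy h hW' with
    ⟨hn', i', hWi', hI'⟩ | ⟨hn', i', j', hWij', hI'⟩ | ⟨hn', i', hWi', hI'⟩ <;>
  try omega
  · rw [hI, hI', Set.singleton_eq_singleton_iff] at heq
    rw [hWi, hWi', heq]
  · rw [hI, hI', Set.pair_eq_pair_iff] at heq
    rcases heq with ⟨rfl, rfl⟩ | ⟨rfl, rfl⟩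
    · rw [hWij, hWij']
    · rw [hWij, hWij', chordLine_comm]
  · rw [hI, hI', compl_inj_iff, Set.singleton_eq_singleton_iff] at heq
    rw [hWi, hWi', heq]

theorem exists_incidence_eq (h : GeneralSextic e θ) {I : Set (Fin 6)}
    (hI : I.ncard = 1 ∨ I.ncard = 2 ∨ I.ncard = 5) :
    ∃ W, IsSurfaceLine e W ∧ incidence e θ W = I := by
  rcases hI with hI | hI | hI
  · obtain ⟨i, rfl⟩ := Set.ncard_eq_one.mp hI
    exact ⟨_, isSurfaceLine_exceptionalLine h i, incidence_exceptionalLine h i⟩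
  · obtain ⟨i, j, hij, rfl⟩ := Set.ncard_eq_two.mp hI
    exact ⟨_, isSurfaceLine_chordLine h hij, incidence_chordLine h hij⟩
  · have hcompl : Iᶜ.ncard = 1 := by rw [Set.ncard_compl, hI, Nat.card_fin]
    obtain ⟨i, hi⟩ := Set.ncard_eq_one.mp hcompl
    refine ⟨_, isSurfaceLine_conicLine h i, ?_⟩
    rw [incidence_conicLine h, ← hi, compl_compl]

end Incidence

section Descent

variable {K L ι : Type*} [Field K] [Field L] [Algebra K L]

/-- A subspace of `L ^ ι` is defined over the subfield `K` if it is spanned by vectors with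
coordinates in `K`. -/
def IsRationalSubspace (K : Type*) [Field K] [Algebra K L] (W : Submodule L (ι → L)) : Prop :=
  ∃ W₀ : Submodule K (ι → K),
    W = Submodule.span L ((fun w j => algebraMap K L (w j)) '' (W₀ : Set (ι → K)))

theorem IsRationalSubspace.comp_mem {W : Submodule L (ι → L)} (hW : IsRationalSubspace K W)
    (σ : L ≃ₐ[K] L) {v : ι → L} (hv : v ∈ W) : σ ∘ v ∈ W := by
  obtain ⟨W₀, rfl⟩ := hW
  induction hv using Submodule.span_induction with
  | mem x hx =>
    obtain ⟨w, hw, rfl⟩ := hx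
    refine Submodule.subset_span ⟨w, hw, ?_⟩
    ext j
    simp
  | zero =>
    convert Submodule.zero_mem _
    ext j
    simp
  | add x y _ _ hx hy =>
    convert add_mem hx hy
    ext j
    simp
  | smul c x _ hx =>
    convert Submodule.smul_mem _ (σ c) hx
    ext j
    simp

theorem exists_fixed_mem_of_comp_mem [Finite ι] {W : Submodule L (ι → L)}
    (hW : ∀ σ : L ≃ₐ[K] L, ∀ v ∈ W, σ ∘ v ∈ W) {v : ι → L} (hv : v ∈ W) (hv0 : v ≠ 0) :
    ∃ u ∈ W, u ≠ 0 ∧ (∀ σ : L ≃ₐ[K] L, σ ∘ u = u) ∧ Function.support u ⊆ Function.support v := by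
  induction hs : Function.support v using WellFoundedLT.induction generalizing v with
  | ind s ih =>
    subst hs
    obtain ⟨j, hj⟩ := Function.ne_iff.mp hv0
    have hwj : ((v j)⁻¹ • v) j = 1 := inv_mul_cancel₀ hj
    have hwW : (v j)⁻¹ • v ∈ W := W.smul_mem _ hv
    have hwv : Function.support ((v j)⁻¹ • v) ⊆ Function.support v :=
      Function.support_const_smul_subset _ _
    generalize (v j)⁻¹ • v = w at hwj hwW hwv
    by_cases hfix : ∀ σ : L ≃ₐ[K] L, σ ∘ w = w
    · refine ⟨w, hwW, fun h0 => ?_, hfix, hwv⟩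
      simp [h0] at hwj
    push Not at hfix
    obtain ⟨σ, hσ⟩ := hfix
    have hsub : Function.support (σ ∘ w - w) ⊆ Function.support v := fun k hk =>
      hwv fun hwk => hk (by simp [hwk])
    have hlt : Function.support (σ ∘ w - w) ⊂ Function.support v :=
      hsub.ssubset_of_mem_notMem hj (by simp [hwj])
    obtain ⟨u, hu, hu0, hufix, hus⟩ :=
      ih _ hlt (sub_mem (hW σ w hwW) hwW) (sub_ne_zero.mpr hσ) rfl
    exact ⟨u, hu, hu0, hufix, hus.trans hsub⟩

theorem mem_span_fixed_of_comp_mem [Finite ι] {W : Submodule L (ι → L)}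
    (hW : ∀ σ : L ≃ₐ[K] L, ∀ v ∈ W, σ ∘ v ∈ W) {v : ι → L} (hv : v ∈ W) :
    v ∈ Submodule.span L {u | u ∈ W ∧ ∀ σ : L ≃ₐ[K] L, σ ∘ u = u} := by
  induction hs : Function.support v using WellFoundedLT.induction generalizing v with
  | ind s ih =>
    subst hs
    rcases eq_or_ne v 0 with rfl | hv0
    · exact zero_mem _
    obtain ⟨u, hu, hu0, hufix, hus⟩ := exists_fixed_mem_of_comp_mem hW hv hv0
    obtain ⟨j, hj⟩ := Function.ne_iff.mp hu0
    have hsub : Function.support (v - (v j / u j) • u) ⊆ Function.support v := fun k hk =>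
      by_contra fun hvk => hk (by
        have huk : u k = 0 := by_contra fun huk => hvk (hus huk)
        have hvk : v k = 0 := by_contra hvk
        simp [huk, hvk])
    have hlt : Function.support (v - (v j / u j) • u) ⊂ Function.support v :=
      hsub.ssubset_of_mem_notMem (hus hj) (by simp [div_mul_cancel₀ _ hj])
    rw [← sub_add_cancel v ((v j / u j) • u)]
    exact add_mem (ih _ hlt (sub_mem hv (W.smul_mem _ hu)) rfl)
      (Submodule.smul_mem _ _ (Submodule.subset_span ⟨hu, hufix⟩))

theorem isRationalSubspace_iff_forall_comp_mem [Finite ι] [IsGalois K L]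
    {W : Submodule L (ι → L)} :
    IsRationalSubspace K W ↔ ∀ σ : L ≃ₐ[K] L, ∀ v ∈ W, σ ∘ v ∈ W := by
  refine ⟨fun hW σ v => hW.comp_mem σ, fun hW => ?_⟩
  let W₀ := (W.restrictScalars K).comap ((Algebra.linearMap K L).compLeft ι)
  refine ⟨W₀, le_antisymm (fun v hv => ?_) (Submodule.span_le.mpr ?_)⟩
  · refine Submodule.span_mono ?_ (mem_span_fixed_of_comp_mem hW hv)
    rintro u ⟨hu, hufix⟩
    choose w hw using fun j => (InfiniteGalois.mem_range_algebraMap_iff_fixed (u j)).mpr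
      fun σ => congrFun (hufix σ) j
    have hwu : (fun j => algebraMap K L (w j)) = u := funext hw
    exact ⟨w, (congrArg (· ∈ W) hwu).mpr hu, hwu⟩
  · rintro _ ⟨w, hw, rfl⟩
    exact hw

/-- The coordinatewise action of a field automorphism on `L ^ ι`, as a semilinear map; the
preimage of a subspace under it is a Galois conjugate of the subspace. -/
def compSemilinear (ι : Type*) (σ : L ≃ₐ[K] L) :
    (ι → L) →ₛₗ[(σ : L →+* L)] (ι → L) where
  toFun v := σ ∘ v
  map_add' v w := by
    ext j
    simp
  map_smul' c v := by
    ext j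
    simp

theorem finrank_comap_compSemilinear (σ : L ≃ₐ[K] L) (W : Submodule L (ι → L)) :
    Module.finrank L (W.comap (compSemilinear ι σ)) = Module.finrank L W := by
  have hright (w : ι → L) : σ ∘ σ.symm ∘ w = w := by
    ext j
    simp
  let i : W.comap (compSemilinear ι σ) ≃+ W :=
    { toFun := fun v => ⟨σ ∘ v.1, v.2⟩
      invFun := fun w => ⟨σ.symm ∘ w.1, (congrArg (· ∈ W) (hright w)).mpr w.2⟩
      left_inv := fun v => by
        ext j
        simp
      right_inv := fun w => Subtype.ext (hright w)
      map_add' := fun v w => by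
        ext j
        simp }
  refine congrArg Cardinal.toNat (rank_eq_of_equiv_equiv σ i σ.bijective fun c v => ?_)
  ext j
  simp [i]

end Descent

section Galois

variable {K L : Type*} [Field K] [Field L] [Algebra K L] {a : Fin 6 → K} {θ : Fin 6 → L}

/-- A set of indices is Galois stable if it is a union of orbits of the Galois action on the
`θ i`. -/
def IsGaloisStable {ι : Type*} (K : Type*) [Field K] [Algebra K L] (θ : ι → L) (I : Set ι) :
    Prop :=
  ∀ (σ : L ≃ₐ[K] L) (i j : ι), σ (θ i) = θ j → i ∈ I → j ∈ I

theorem syzMatrix_comp_algEquiv (a : Fin 6 → K) (σ : L ≃ₐ[K] L) (v : Fin 4 → L) :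
    syzMatrix (algebraMap K L ∘ a) (σ ∘ v) =
      (syzMatrix (algebraMap K L ∘ a) v).map (σ : L →+* L) := by
  have hσ : (σ : L →+* L) ∘ (algebraMap K L ∘ a) = algebraMap K L ∘ a := by
    ext j
    simp
  rw [map_syzMatrix, hσ]
  rfl

theorem comp_mem_exceptionalLine (σ : L ≃ₐ[K] L) {t : L} {v : Fin 4 → L}
    (hv : v ∈ exceptionalLine (algebraMap K L ∘ a) t) :
    σ ∘ v ∈ exceptionalLine (algebraMap K L ∘ a) (σ t) := by
  rw [mem_exceptionalLine] at hv ⊢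
  have hσ : cuspPoint (σ t) = (σ : L →+* L) ∘ cuspPoint t := by
    ext j
    fin_cases j <;> simp [cuspPoint]
  ext i
  rw [syzMatrix_comp_algEquiv, hσ, ← RingHom.map_mulVec, hv]
  simp

theorem GeneralSextic.exists_root_eq (h : GeneralSextic (algebraMap K L ∘ a) θ) (σ : L ≃ₐ[K] L)
    (i : Fin 6) : ∃ j, θ j = σ (θ i) := by
  have hi : σ (sextic (algebraMap K L ∘ a) (θ i)) = σ 0 := congrArg σ (h.sextic_eq_zero i)
  rw [← h.sextic_eq_zero_iff]
  simpa [sextic] using hi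

variable {W : Submodule L (Fin 4 → L)}

theorem IsSurfaceLine.comap_compSemilinear (hW : IsSurfaceLine (algebraMap K L ∘ a) W)
    (σ : L ≃ₐ[K] L) : IsSurfaceLine (algebraMap K L ∘ a) (W.comap (compSemilinear (Fin 4) σ)) := by
  refine ⟨by rw [finrank_comap_compSemilinear, hW.1], fun v hv => ?_⟩
  have hdet : (syzMatrix (algebraMap K L ∘ a) (σ ∘ v)).det = 0 := hW.2 _ hv
  rw [syzMatrix_comp_algEquiv, ← RingHom.mapMatrix_apply, ← RingHom.map_det] at hdet
  exact (map_eq_zero _).mp hdet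

theorem comp_ne_zero {ι : Type*} (σ : L ≃ₐ[K] L) {v : ι → L} (hv : v ≠ 0) : σ ∘ v ≠ 0 :=
  fun h0 => hv (funext fun k => (map_eq_zero σ).mp (congrFun h0 k))

theorem mem_incidence_of_mem_incidence_comap (σ : L ≃ₐ[K] L) {i j : Fin 6}
    (hij : σ (θ i) = θ j)
    (hi : i ∈ incidence (algebraMap K L ∘ a) θ (W.comap (compSemilinear (Fin 4) σ))) :
    j ∈ incidence (algebraMap K L ∘ a) θ W := by
  obtain ⟨v, hv, hv0, hvi⟩ := hi
  exact ⟨σ ∘ v, hv, comp_ne_zero σ hv0, hij ▸ comp_mem_exceptionalLine σ hvi⟩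

theorem isRationalSubspace_iff_isGaloisStable [IsAlgClosed L] [IsGalois K L]
    (h : GeneralSextic (algebraMap K L ∘ a) θ) (hW : IsSurfaceLine (algebraMap K L ∘ a) W) :
    IsRationalSubspace K W ↔ IsGaloisStable K θ (incidence (algebraMap K L ∘ a) θ W) := by
  have hcomap (σ : L ≃ₐ[K] L) (U : Submodule L (Fin 4 → L)) :
      (U.comap (compSemilinear (Fin 4) σ)).comap (compSemilinear (Fin 4) σ.symm) = U := by
    ext v
    have hv : σ ∘ σ.symm ∘ v = v := by
      ext k
      simp
    exact iff_of_eq (congrArg (· ∈ U) hv)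
  rw [isRationalSubspace_iff_forall_comp_mem]
  constructor
  · rintro hr σ i j hij ⟨v, hv, hv0, hvi⟩
    exact ⟨σ ∘ v, hr σ v hv, comp_ne_zero σ hv0, hij ▸ comp_mem_exceptionalLine σ hvi⟩
  · intro hI σ
    suffices hinc : incidence (algebraMap K L ∘ a) θ (W.comap (compSemilinear (Fin 4) σ)) =
        incidence (algebraMap K L ∘ a) θ W from
      (incidence_injOn h (hW.comap_compSemilinear σ) hW hinc).ge
    ext i
    obtain ⟨j, hj⟩ := h.exists_root_eq σ i
    have hji : σ.symm (θ j) = θ i := by simp [hj]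
    constructor
    · exact fun hi => hI σ.symm j i hji (mem_incidence_of_mem_incidence_comap σ hj.symm hi)
    · intro hi
      refine mem_incidence_of_mem_incidence_comap σ.symm hji ?_
      rw [hcomap]
      exact hI σ i j hj.symm hi

end Galois

section BiprojectiveClosure

variable {L : Type*} [Field L]

theorem subset_biprojectiveClosure {m n : ℕ} (S : Set (ℙ L (Fin m → L) × ℙ L (Fin n → L))) :
    S ⊆ biprojectiveClosure S :=
  fun z hz _ hg => hg z hz

theorem eval_eq_zero_of_forall_eval_ne_zero [Infinite L] {ι : Type*} {g : MvPolynomial ι L}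
    {γ : ι → L[X]} {q : L[X]} (hq : q ≠ 0)
    (h : ∀ s, q.eval s ≠ 0 → MvPolynomial.eval (fun i => (γ i).eval s) g = 0) (s : L) :
    MvPolynomial.eval (fun i => (γ i).eval s) g = 0 := by
  have heval (s : L) :
      (MvPolynomial.aeval γ g).eval s = MvPolynomial.eval (fun i => (γ i).eval s) g := by
    have hcomp : (Polynomial.evalRingHom s).comp (algebraMap L L[X]) = RingHom.id L := by
      ext x
      simp
    rw [← Polynomial.coe_evalRingHom, MvPolynomial.map_aeval, hcomp]
    rfl
  have hzero : MvPolynomial.aeval γ g * q = 0 := by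
    refine Polynomial.funext fun s => ?_
    rw [Polynomial.eval_mul, Polynomial.eval_zero, heval, mul_eq_zero]
    exact or_iff_not_imp_right.mpr (h s)
  rw [← heval, (mul_eq_zero.mp hzero).resolve_right hq, Polynomial.eval_zero]

theorem mk_mem_biprojectiveClosure_of_curve [Infinite L] {m n : ℕ}
    {S : Set (ℙ L (Fin m → L) × ℙ L (Fin n → L))} {γ : Fin m → L[X]} {δ : Fin n → L[X]} {q : L[X]}
    (hq : q ≠ 0)
    (h : ∀ s, q.eval s ≠ 0 → ∃ hu hv, (Projectivization.mk L (fun i => (γ i).eval s) hu,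
      Projectivization.mk L (fun i => (δ i).eval s) hv) ∈ S)
    (s : L) (hu : (fun i => (γ i).eval s) ≠ 0) (hv : (fun i => (δ i).eval s) ≠ 0) :
    (Projectivization.mk L _ hu, Projectivization.mk L _ hv) ∈ biprojectiveClosure S := by
  intro g hg u' hu' v' hv' huv
  obtain ⟨⟨c, rfl⟩, d, rfl⟩ := (Prod.mk.injEq _ _ _ _ ▸ huv).imp
    (Projectivization.mk_eq_mk_iff' L _ _ hu' hu).mp
    (Projectivization.mk_eq_mk_iff' L _ _ hv' hv).mp
  have hcd (r : L) : (fun i => (Sum.elim (fun i => C c * γ i) (fun i => C d * δ i) i).eval r) =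
      Sum.elim (c • fun i => (γ i).eval r) (d • fun i => (δ i).eval r) := by
    ext (i | i) <;> simp
  rw [← hcd]
  refine eval_eq_zero_of_forall_eval_ne_zero hq (fun r hr => ?_) s
  obtain ⟨hur, hvr, hr⟩ := h r hr
  have hc0 : c ≠ 0 := left_ne_zero_of_smul hu'
  have hd0 : d ≠ 0 := left_ne_zero_of_smul hv'
  rw [hcd]
  refine hg _ hr _ (smul_ne_zero hc0 hur) _ (smul_ne_zero hd0 hvr) (Prod.ext ?_ ?_)
  · exact (Projectivization.mk_eq_mk_iff' L _ _ _ _).mpr ⟨c, rfl⟩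
  · exact (Projectivization.mk_eq_mk_iff' L _ _ _ _).mpr ⟨d, rfl⟩

theorem mk_mem_rationalMapGraph {f : Fin 4 → MvPolynomial (Fin 3) L} {u : Fin 3 → L}
    {v : Fin 4 → L} {c : L} (hu : u ≠ 0) (hv : v ≠ 0)
    (h : v = c • fun j => MvPolynomial.eval u (f j)) :
    (Projectivization.mk L u hu, Projectivization.mk L v hv) ∈ rationalMapGraph f :=
  ⟨u, hu, right_ne_zero_of_smul (h ▸ hv),
    Prod.ext rfl ((Projectivization.mk_eq_mk_iff' L _ _ _ _).mpr ⟨c, h.symm⟩)⟩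

end BiprojectiveClosure

section BlowUp

variable {L : Type*} [Field L] {e θ : Fin 6 → L} {u : Fin 3 → L}

theorem exists_curve_cubicMap (hc : cubicMap e u = 0) (x : Fin 3 → L) :
    ∃ d : Fin 4 → L[X], (∀ s, cubicMap e (u + s • x) = s • fun j => (d j).eval s) ∧
      (fun j => (d j).eval 0) = cubicDeriv e u x := by
  refine ⟨fun j => C (cubicDeriv e u x j) + X * C (cubicDeriv e x u j) + X ^ 2 * C (cubicMap e x j),
    fun s => ?_, ?_⟩
  · rw [cubicMap_add_smul, hc]
    ext j
    simp only [Pi.add_apply, Pi.smul_apply, Pi.zero_apply, smul_eq_mul, eval_add, eval_mul, eval_C,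
      eval_X, eval_pow]
    ring
  · ext j
    simp

theorem exists_cubicDeriv_eq_of_mulVec_eq_zero (h : GeneralSextic e θ) (hu : u ≠ 0)
    (hc : cubicMap e u = 0) {v : Fin 4 → L} (hz : syzMatrix e v *ᵥ u = 0) :
    ∃ x, cubicDeriv e u x = v := by
  obtain ⟨i, c, hc0, rfl⟩ := exists_eq_smul_cuspPoint h hu hc
  rw [Matrix.mulVec_smul, smul_eq_zero_iff_right hc0] at hz
  obtain ⟨w, rfl⟩ := exists_cubicDeriv_eq h i (mem_exceptionalLine.mpr hz)
  refine ⟨(c ^ 2)⁻¹ • w, ?_⟩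
  rw [cubicDeriv_smul_left, cubicDeriv_smul_right, smul_inv_smul₀ (pow_ne_zero 2 hc0)]

/-- The bilinear syzygies `syzMatrix e (B *ᵥ v) *ᵥ u` as polynomials in the two groups of variables
`u` and `v`. -/
noncomputable def syzPolynomial (e : Fin 6 → L) (B : Matrix (Fin 4) (Fin 4) L) :
    Fin 3 → MvPolynomial (Fin 3 ⊕ Fin 4) L :=
  syzMatrix (MvPolynomial.C ∘ e)
    (B.map MvPolynomial.C *ᵥ fun l => MvPolynomial.X (Sum.inr l)) *ᵥ
      fun j => MvPolynomial.X (Sum.inl j)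

theorem eval_syzPolynomial (B : Matrix (Fin 4) (Fin 4) L) (i : Fin 3) (v : Fin 4 → L) :
    MvPolynomial.eval (Sum.elim u v) (syzPolynomial e B i) = (syzMatrix e (B *ᵥ v) *ᵥ u) i := by
  rw [syzPolynomial, RingHom.map_mulVec, map_syzMatrix]
  congr 3
  · ext k
    simp
  · ext k
    simp [Matrix.mulVec, dotProduct]
  · ext k
    simp

variable {A B : Matrix (Fin 4) (Fin 4) L} {f : Fin 4 → MvPolynomial (Fin 3) L}

theorem mulVec_eq_zero_of_mk_mem_blowUp (hAB : A * B = 1)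
    (hf : ∀ u, (fun j => MvPolynomial.eval u (f j)) = A *ᵥ cubicMap e u)
    {hu : u ≠ 0} {v : Fin 4 → L} {hv : v ≠ 0}
    (hz : (Projectivization.mk L u hu, Projectivization.mk L v hv) ∈ blowUp f) :
    syzMatrix e (B *ᵥ v) *ᵥ u = 0 := by
  ext i
  rw [← eval_syzPolynomial]
  refine hz (syzPolynomial e B i) ?_ u hu v hv rfl
  rintro _ ⟨u₀, hu₀, hv₀, rfl⟩ u hu v hv huv
  rw [Prod.mk.injEq, Projectivization.mk_eq_mk_iff', Projectivization.mk_eq_mk_iff'] at huv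
  obtain ⟨⟨c, rfl⟩, ⟨d, rfl⟩⟩ := huv
  have hB : B *ᵥ A *ᵥ cubicMap e u₀ = cubicMap e u₀ := by
    rw [Matrix.mulVec_mulVec, mul_eq_one_comm.mp hAB, Matrix.one_mulVec]
  rw [eval_syzPolynomial, hf, Matrix.mulVec_smul B d, hB, map_smul, Matrix.smul_mulVec,
    Matrix.mulVec_smul, syzMatrix_cubicMap_mulVec, smul_zero, smul_zero,
    Pi.zero_apply]

theorem mk_mem_blowUp_of_cubicMap_ne_zero (h0 : e 0 ≠ 0) (hAB : A * B = 1)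
    (hf : ∀ u, (fun j => MvPolynomial.eval u (f j)) = A *ᵥ cubicMap e u)
    {hu : u ≠ 0} {v : Fin 4 → L} {hv : v ≠ 0} (hc : cubicMap e u ≠ 0)
    (hz : syzMatrix e (B *ᵥ v) *ᵥ u = 0) :
    (Projectivization.mk L u hu, Projectivization.mk L v hv) ∈ blowUp f := by
  obtain ⟨c, hcv⟩ := eq_smul_cubicMap h0 hc hz
  refine subset_biprojectiveClosure _ (mk_mem_rationalMapGraph (c := c) hu hv ?_)
  rw [hf, ← Matrix.mulVec_smul, ← hcv, Matrix.mulVec_mulVec, hAB, Matrix.one_mulVec]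

-- Over a base point, the fibre of the blow-up is swept out by the limits of the graph along the
-- lines through the base point.
theorem mk_mem_blowUp_of_cubicMap_eq_zero [Infinite L]
    (hf : ∀ u, (fun j => MvPolynomial.eval u (f j)) = A *ᵥ cubicMap e u)
    {hu : u ≠ 0} {x : Fin 3 → L} {hv : A *ᵥ cubicDeriv e u x ≠ 0} (hc : cubicMap e u = 0) :
    (Projectivization.mk L u hu, Projectivization.mk L (A *ᵥ cubicDeriv e u x) hv) ∈ blowUp f := by
  obtain ⟨d, hd, hd0⟩ := exists_curve_cubicMap hc x
  let γ : Fin 3 → L[X] := fun i => C (u i) + X * C (x i)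
  let δ : Fin 4 → L[X] := A.map C *ᵥ d
  have hγ (s : L) : (fun i => (γ i).eval s) = u + s • x := by
    ext i
    simp only [γ, eval_add, eval_mul, eval_X, eval_C, Pi.add_apply, Pi.smul_apply, smul_eq_mul]
  have hδ (s : L) : (fun j => (δ j).eval s) = A *ᵥ fun j => (d j).eval s := by
    ext j
    simp [δ, Matrix.mulVec, dotProduct, Polynomial.eval_finsetSum]
  have hγ0 : (fun i => (γ i).eval 0) = u := by simp [hγ]
  have hδ0 : (fun j => (δ j).eval 0) = A *ᵥ cubicDeriv e u x := by rw [hδ, hd0]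
  obtain ⟨j, hj⟩ := Function.ne_iff.mp hv
  have hq : X * δ j ≠ 0 := mul_ne_zero X_ne_zero fun h0 => hj (by
    rw [← hδ0]
    simp [h0])
  have key := mk_mem_biprojectiveClosure_of_curve (S := rationalMapGraph f) (γ := γ) (δ := δ) hq
    (fun s hs => ?_) 0 (hγ0 ▸ hu) (hδ0 ▸ hv)
  · simp only [hγ0, hδ0] at key
    exact key
  · rw [eval_mul, eval_X, mul_ne_zero_iff] at hs
    have hfs : (fun j => MvPolynomial.eval (u + s • x) (f j)) = s • fun j => (δ j).eval s := by
      rw [hf, hd, hδ, Matrix.mulVec_smul]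
    have hds : (fun j => (δ j).eval s) ≠ 0 := Function.ne_iff.mpr ⟨j, hs.2⟩
    have hus : u + s • x ≠ 0 := fun h0 => hds (by
      have hzero : cubicMap e (0 : Fin 3 → L) = 0 := by
        simpa using cubicMap_smul e 0 (0 : Fin 3 → L)
      have hd : (fun j => (d j).eval s) = 0 :=
        (smul_eq_zero_iff_right hs.1).mp (by rw [← hd, h0, hzero])
      rw [hδ, hd, Matrix.mulVec_zero])
    simp only [hγ]
    refine ⟨hus, hds, mk_mem_rationalMapGraph (c := s⁻¹) hus hds ?_⟩
    rw [hfs, inv_smul_smul₀ hs.1]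

theorem mk_mem_blowUp_iff [IsAlgClosed L] (h : GeneralSextic e θ) (hAB : A * B = 1)
    (hf : ∀ u, (fun j => MvPolynomial.eval u (f j)) = A *ᵥ cubicMap e u)
    {hu : u ≠ 0} {v : Fin 4 → L} {hv : v ≠ 0} :
    (Projectivization.mk L u hu, Projectivization.mk L v hv) ∈ blowUp f ↔
      syzMatrix e (B *ᵥ v) *ᵥ u = 0 := by
  refine ⟨mulVec_eq_zero_of_mk_mem_blowUp hAB hf, fun hz => ?_⟩
  rcases ne_or_eq (cubicMap e u) 0 with hc | hc
  · exact mk_mem_blowUp_of_cubicMap_ne_zero h.coeff_ne_zero hAB hf hc hz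
  · obtain ⟨x, hx⟩ := exists_cubicDeriv_eq_of_mulVec_eq_zero h hu hc hz
    obtain rfl : v = A *ᵥ cubicDeriv e u x := by
      rw [hx, Matrix.mulVec_mulVec, hAB, Matrix.one_mulVec]
    exact mk_mem_blowUp_of_cubicMap_eq_zero hf hc

theorem mk_mem_blowUpSurface_iff [IsAlgClosed L] (h : GeneralSextic e θ) (hAB : A * B = 1)
    (hf : ∀ u, (fun j => MvPolynomial.eval u (f j)) = A *ᵥ cubicMap e u)
    {v : Fin 4 → L} {hv : v ≠ 0} :
    Projectivization.mk L v hv ∈ blowUpSurface f ↔ (syzMatrix e (B *ᵥ v)).det = 0 := by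
  rw [← Matrix.exists_mulVec_eq_zero_iff]
  constructor
  · rintro ⟨⟨x, y⟩, hxy, rfl : y = _⟩
    induction x using Projectivization.ind with
    | h u hu => exact ⟨u, hu, (mk_mem_blowUp_iff h hAB hf).mp hxy⟩
  · rintro ⟨u, hu, huv⟩
    exact ⟨(Projectivization.mk L u hu, Projectivization.mk L v hv),
      (mk_mem_blowUp_iff h hAB hf).mpr huv, rfl⟩

theorem injOn_snd_blowUp [IsAlgClosed L] (h : GeneralSextic e θ) (hAB : A * B = 1)
    (hf : ∀ u, (fun j => MvPolynomial.eval u (f j)) = A *ᵥ cubicMap e u) :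
    Set.InjOn Prod.snd (blowUp f) := by
  rintro ⟨x, y⟩ hxy ⟨x', y'⟩ hxy' (rfl : y = y')
  induction x using Projectivization.ind with | h u hu
  induction x' using Projectivization.ind with | h u' hu'
  induction y using Projectivization.ind with | h v hv
  rw [mk_mem_blowUp_iff h hAB hf] at hxy hxy'
  have hBv : B *ᵥ v ≠ 0 := fun h0 => hv (by
    rw [← Matrix.one_mulVec v, ← hAB, ← Matrix.mulVec_mulVec, h0, Matrix.mulVec_zero])
  obtain ⟨c, hc⟩ := eq_smul_of_mulVec_eq_zero h hBv hu' hxy' hxy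
  exact Prod.ext ((Projectivization.mk_eq_mk_iff' L u u' hu hu').mpr ⟨c, hc.symm⟩) rfl

end BlowUp

section Determinants

open MvPolynomial in
theorem isHomogeneous_det {σ n R : Type*} [CommRing R] [Fintype n] [DecidableEq n]
    {M : Matrix n n (MvPolynomial σ R)} {d : ℕ} (hM : ∀ i j, (M i j).IsHomogeneous d) :
    M.det.IsHomogeneous (Fintype.card n * d) := by
  rw [Matrix.det_apply]
  refine IsHomogeneous.sum _ _ _ fun π _ => ?_
  have hprod : (∏ i, M (π i) i).IsHomogeneous (∑ _i : n, d) :=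
    IsHomogeneous.prod _ _ _ fun i _ => hM (π i) i
  rw [Finset.sum_const, smul_eq_mul, Finset.card_univ] at hprod
  rcases Int.units_eq_one_or (Equiv.Perm.sign π) with h | h <;> rw [h]
  · rwa [one_smul]
  · simpa using hprod.neg

theorem derivation_prod {R A ι : Type*} [CommRing R] [CommRing A] [Algebra R A] [DecidableEq ι]
    (D : Derivation R A A) (s : Finset ι) (f : ι → A) :
    D (∏ i ∈ s, f i) = ∑ i ∈ s, (∏ j ∈ s.erase i, f j) * D (f i) := by
  induction s using Finset.induction_on with
  | empty => simp
  | insert i s hi ih =>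
    rw [Finset.prod_insert hi, D.leibniz, ih, Finset.sum_insert hi, Finset.erase_insert hi,
      add_comm, smul_eq_mul, smul_eq_mul, Finset.mul_sum]
    refine congrArg _ (Finset.sum_congr rfl fun j hj => ?_)
    have hij : i ≠ j := fun h => hi (h ▸ hj)
    rw [Finset.erase_insert_of_ne hij, Finset.prod_insert fun h => hi (Finset.mem_of_mem_erase h),
      mul_assoc]

theorem derivation_det {R A n : Type*} [CommRing R] [CommRing A] [Algebra R A] [Fintype n]
    [DecidableEq n] (D : Derivation R A A) (M : Matrix n n A) :
    D M.det = (M.adjugate * M.map D).trace := by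
  have hcol (i : n) : (M.adjugate * M.map D) i i = (M.updateCol i fun k => D (M k i)).det := by
    rw [← Matrix.cramer_apply, Matrix.cramer_eq_adjugate_mulVec]
    rfl
  have hterm (i : n) : (M.updateCol i fun k => D (M k i)).det =
      ∑ π : Equiv.Perm n, Equiv.Perm.sign π •
        ((∏ j ∈ Finset.univ.erase i, M (π j) j) * D (M (π i) i)) := by
    rw [Matrix.det_apply]
    refine Finset.sum_congr rfl fun π _ => ?_
    rw [← Finset.prod_erase_mul _ _ (Finset.mem_univ i), Matrix.updateCol_self]
    congr 2
    refine Finset.prod_congr rfl fun j hj => ?_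
    rw [Matrix.updateCol_ne (Finset.ne_of_mem_erase hj)]
  simp only [Matrix.trace, Matrix.diag_apply, hcol, hterm]
  rw [Finset.sum_comm, Matrix.det_apply, map_sum]
  refine Finset.sum_congr rfl fun π _ => ?_
  rw [← Finset.smul_sum, ← derivation_prod, Units.smul_def, map_zsmul, Units.smul_def]

end Determinants

section Smooth

variable {K L : Type*} [Field K] [Field L] [Algebra K L] {a : Fin 6 → K} {θ : Fin 6 → L}

/-- The syzygy matrix at the generic point of projective three-space, in coordinates changed by the
matrix `H`: a matrix of linear forms. -/
noncomputable def surfaceMatrix (a : Fin 6 → K) (H : Matrix (Fin 4) (Fin 4) K) :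
    Matrix (Fin 3) (Fin 3) (MvPolynomial (Fin 4) K) :=
  Matrix.of fun i j => ∑ k, MvPolynomial.C (syzMatrix a (H.col k) i j) * MvPolynomial.X k

theorem isHomogeneous_det_surfaceMatrix (a : Fin 6 → K) (H : Matrix (Fin 4) (Fin 4) K) :
    (surfaceMatrix a H).det.IsHomogeneous 3 := by
  have hentry (i j : Fin 3) : (surfaceMatrix a H i j).IsHomogeneous 1 := by
    rw [surfaceMatrix, Matrix.of_apply]
    exact MvPolynomial.IsHomogeneous.sum Finset.univ _ _ fun k _ =>
      MvPolynomial.isHomogeneous_C_mul_X _ k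
  exact isHomogeneous_det hentry

theorem map_pderiv_surfaceMatrix (H : Matrix (Fin 4) (Fin 4) K) (k : Fin 4) :
    (surfaceMatrix a H).map (MvPolynomial.pderiv k) =
      (syzMatrix a (H.col k)).map MvPolynomial.C := by
  ext1 i j
  simp [surfaceMatrix, MvPolynomial.pderiv_X, Pi.single_apply]

theorem map_syzMatrix_col (H : Matrix (Fin 4) (Fin 4) K) (k : Fin 4) :
    (syzMatrix a (H.col k)).map (algebraMap K L) =
      syzMatrix (algebraMap K L ∘ a) (H.map (algebraMap K L) *ᵥ Pi.single k 1) := by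
  rw [map_syzMatrix, Matrix.mulVec_single_one]
  rfl

theorem map_aeval_surfaceMatrix (H : Matrix (Fin 4) (Fin 4) K) (v : Fin 4 → L) :
    (surfaceMatrix a H).map (MvPolynomial.aeval v) =
      syzMatrix (algebraMap K L ∘ a) (H.map (algebraMap K L) *ᵥ v) := by
  have hv : v = ∑ k, v k • Pi.single k 1 := by
    ext j
    simp [Pi.single_apply]
  conv_rhs => rw [hv, Matrix.mulVec_sum, map_sum]
  simp only [Matrix.mulVec_smul, map_smul, ← map_syzMatrix_col]
  ext i j
  simp [surfaceMatrix, Matrix.sum_apply, mul_comm]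

theorem aeval_det_surfaceMatrix (H : Matrix (Fin 4) (Fin 4) K) (v : Fin 4 → L) :
    MvPolynomial.aeval v (surfaceMatrix a H).det =
      (syzMatrix (algebraMap K L ∘ a) (H.map (algebraMap K L) *ᵥ v)).det := by
  rw [AlgHom.map_det, AlgHom.mapMatrix_apply, map_aeval_surfaceMatrix]

theorem aeval_pderiv_det_surfaceMatrix (H : Matrix (Fin 4) (Fin 4) K) (v : Fin 4 → L) (k : Fin 4) :
    MvPolynomial.aeval v (MvPolynomial.pderiv k (surfaceMatrix a H).det) =
      ((syzMatrix (algebraMap K L ∘ a) (H.map (algebraMap K L) *ᵥ v)).adjugate *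
        syzMatrix (algebraMap K L ∘ a) (H.map (algebraMap K L) *ᵥ Pi.single k 1)).trace := by
  have hC : ((syzMatrix a (H.col k)).map MvPolynomial.C).map
      (MvPolynomial.aeval v : MvPolynomial (Fin 4) K →ₐ[K] L) =
        (syzMatrix a (H.col k)).map (algebraMap K L) := by
    ext1 i j
    simp
  rw [derivation_det, map_pderiv_surfaceMatrix, AddMonoidHom.map_trace, Matrix.map_mul,
    ← map_aeval_surfaceMatrix, ← map_syzMatrix_col, ← hC, ← AlgHom.mapMatrix_apply,
    AlgHom.map_adjugate, AlgHom.mapMatrix_apply]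

theorem isSmoothCubicSurfaceOver_blowUpSurface [IsAlgClosed L]
    (h : GeneralSextic (algebraMap K L ∘ a) θ) {G H : Matrix (Fin 4) (Fin 4) K}
    (hGH : G.map (algebraMap K L) * H.map (algebraMap K L) = 1)
    {f : Fin 4 → MvPolynomial (Fin 3) L}
    (hf : ∀ u, (fun j => MvPolynomial.eval u (f j)) =
      G.map (algebraMap K L) *ᵥ cubicMap (algebraMap K L ∘ a) u) :
    IsSmoothCubicSurfaceOver K (blowUpSurface f) := by
  refine ⟨(surfaceMatrix a H).det, isHomogeneous_det_surfaceMatrix a H, fun v hv => ?_,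
    fun v hv hz => ?_⟩
  · rw [mk_mem_blowUpSurface_iff h hGH hf, aeval_det_surfaceMatrix]
  by_contra! hd
  rw [aeval_det_surfaceMatrix] at hz
  simp only [aeval_pderiv_det_surfaceMatrix] at hd
  set M := syzMatrix (algebraMap K L ∘ a) (H.map (algebraMap K L) *ᵥ v)
  let gradient : (Fin 4 → L) →ₗ[L] L := Matrix.traceLinearMap (Fin 3) L L ∘ₗ
    LinearMap.mulLeft L M.adjugate ∘ₗ syzMatrix (algebraMap K L ∘ a) ∘ₗ
      (H.map (algebraMap K L)).mulVecLin
  have hgradient : gradient = 0 := LinearMap.pi_ext' fun k => LinearMap.ext_ring (hd k)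
  have hHv : H.map (algebraMap K L) *ᵥ v = 0 := by
    refine eq_zero_of_trace_adjugate_mul h hz fun x => ?_
    have hx : H.map (algebraMap K L) *ᵥ G.map (algebraMap K L) *ᵥ x = x := by
      rw [Matrix.mulVec_mulVec, mul_eq_one_comm.mp hGH, Matrix.one_mulVec]
    have hGx : (M.adjugate * syzMatrix (algebraMap K L ∘ a)
        (H.map (algebraMap K L) *ᵥ G.map (algebraMap K L) *ᵥ x)).trace = 0 :=
      LinearMap.congr_fun hgradient (G.map (algebraMap K L) *ᵥ x)
    rwa [hx] at hGx
  refine hv ?_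
  rw [← Matrix.one_mulVec v, ← hGH, ← Matrix.mulVec_mulVec, hHv, Matrix.mulVec_zero]

end Smooth

section TernaryCubics

variable {R : Type*} [CommRing R]

/-- The exponents of the ten ternary cubic monomials. The first six come first because they
restrict to `1, t, …, t ^ 5` on the cuspidal cubic `(1 : t : t ^ 3)`. -/
def cubicExponents : Fin 10 → Fin 3 → ℕ :=
  ![![3, 0, 0], ![2, 1, 0], ![1, 2, 0], ![2, 0, 1], ![1, 1, 1], ![0, 2, 1],
    ![0, 3, 0], ![1, 0, 2], ![0, 1, 2], ![0, 0, 3]]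

/-- The ten ternary cubic monomials, as a basis of the space of ternary cubic forms. -/
noncomputable def cubicMonomials (R : Type*) [CommRing R] (i : Fin 10) : MvPolynomial (Fin 3) R :=
  MvPolynomial.monomial (Finsupp.equivFunOnFinite.symm (cubicExponents i)) 1

theorem linearIndependent_cubicMonomials : LinearIndependent R (cubicMonomials R) := by
  have hinj : Function.Injective cubicExponents := by decide
  have hli := (MvPolynomial.basisMonomials (Fin 3) R).linearIndependent.comp _
    (Finsupp.equivFunOnFinite.symm.injective.comp hinj)
  rwa [MvPolynomial.coe_basisMonomials] at hli

theorem span_range_cubicMonomials :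
    Submodule.span R (Set.range (cubicMonomials R)) =
      MvPolynomial.homogeneousSubmodule (Fin 3) R 3 := by
  have hmem : ∀ i, ∑ k, cubicExponents i k = 3 := by decide
  have hsurj : ∀ x ∈ Finset.Nat.antidiagonalTuple 3 3, ∃ i, cubicExponents i = x := by decide
  have hrange : Set.range (fun i => Finsupp.equivFunOnFinite.symm (cubicExponents i)) =
      {d : Fin 3 →₀ ℕ | d.degree = 3} := by
    ext d
    rw [Set.mem_ofPred_eq, Finsupp.degree_eq_sum]
    constructor
    · rintro ⟨i, rfl⟩
      exact hmem i
    · intro hd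
      obtain ⟨i, hi⟩ := hsurj d (Finset.Nat.mem_antidiagonalTuple.mpr hd)
      exact ⟨i, DFunLike.coe_injective hi⟩
  rw [MvPolynomial.homogeneousSubmodule_eq_finsupp_supported,
    AddMonoidAlgebra.supported_eq_span_single, ← hrange, ← Set.range_comp]
  rfl

theorem cubicMonomials_eq (i : Fin 10) :
    cubicMonomials R i = MvPolynomial.X 0 ^ cubicExponents i 0 *
      MvPolynomial.X 1 ^ cubicExponents i 1 * MvPolynomial.X 2 ^ cubicExponents i 2 := by
  rw [cubicMonomials, MvPolynomial.monomial_eq, MvPolynomial.C_1, one_mul,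
    Finsupp.prod_fintype _ _ fun _ => pow_zero _, Fin.prod_univ_three]
  rfl

theorem aeval_cuspPoint_cubicMonomials {K L : Type*} [Field K] [Field L] [Algebra K L] (t : L)
    (i : Fin 6) :
    MvPolynomial.aeval (cuspPoint t) (cubicMonomials K (Fin.castAdd 4 i)) = t ^ (i : ℕ) := by
  rw [cubicMonomials_eq]
  fin_cases i <;> simp [cubicExponents, cuspPoint] <;> ring

/-- The components of `cubicMap a` as cubic forms. -/
noncomputable def basisCubics (a : Fin 6 → R) : Fin 4 → MvPolynomial (Fin 3) R :=
  cubicMap (MvPolynomial.C ∘ a) MvPolynomial.X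

/-- The coefficients of the cubic forms `basisCubics a` with respect to `cubicMonomials`. -/
def basisCoeffs (a : Fin 6 → R) : Matrix (Fin 4) (Fin 10) R :=
  !![0, 0, 0, 1, 0, 0, -1, 0, 0, 0;
    a 5, -a 4, a 3, -a 2, a 1, -a 0, 0, 1, 0, 0;
    0, a 5, -a 4, a 3, -a 2, a 1, 0, -a 0, 1, 0;
    0, 0, a 0 * a 5, a 5 - a 0 * a 4, a 0 * a 3 - a 4, a 3 - a 0 * a 2, 0, a 0 * a 1 - a 2,
      a 1 - a 0 ^ 2, 1]

theorem basisCubics_eq_sum (a : Fin 6 → R) (k : Fin 4) :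
    basisCubics a k = ∑ i, basisCoeffs a k i • cubicMonomials R i := by
  simp only [cubicMonomials_eq, MvPolynomial.smul_eq_C_mul, Fin.sum_univ_succ]
  fin_cases k <;> simp [basisCubics, cubicMap, basisCoeffs, cubicExponents] <;> ring

theorem sum_smul_basisCubics (a : Fin 6 → R) (g : Fin 4 → R) :
    ∑ k, g k • basisCubics a k = ∑ i, (g ᵥ* basisCoeffs a) i • cubicMonomials R i := by
  simp only [basisCubics_eq_sum, Finset.smul_sum, smul_smul, Matrix.vecMul, dotProduct,
    Finset.sum_smul]
  exact Finset.sum_comm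

theorem det_basisCoeffs_submatrix_natAdd (a : Fin 6 → R) :
    ((basisCoeffs a).submatrix id (Fin.natAdd (m := 4) 6)).det = -1 := by
  have hN : (basisCoeffs a).submatrix id (Fin.natAdd (m := 4) 6) = !![-1, 0, 0, 0; 0, 1, 0, 0;
      0, -a 0, 1, 0; 0, a 0 * a 1 - a 2, a 1 - a 0 ^ 2, 1] := by
    ext i j
    fin_cases i <;> fin_cases j <;> rfl
  rw [hN]
  simp [Matrix.det_succ_row_zero, Fin.sum_univ_succ]

end TernaryCubics

section RationalBasis

variable {K L : Type*} [Field K] [Field L] [Algebra K L] {a : Fin 6 → K} {θ : Fin 6 → L}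

theorem linearIndependent_basisCubics (a : Fin 6 → K) : LinearIndependent K (basisCubics a) := by
  rw [Fintype.linearIndependent_iff]
  intro g hg
  rw [sum_smul_basisCubics] at hg
  have hcoeff := Fintype.linearIndependent_iff.mp linearIndependent_cubicMonomials _ hg
  have hdet : ((basisCoeffs a).submatrix id (Fin.natAdd (m := 4) 6)).det ≠ 0 := by
    rw [det_basisCoeffs_submatrix_natAdd]
    exact neg_ne_zero.mpr one_ne_zero
  exact congrFun (Matrix.eq_zero_of_vecMul_eq_zero hdet (funext fun j => hcoeff (Fin.natAdd 6 j)))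

theorem aeval_basisCubics (a : Fin 6 → K) (u : Fin 3 → L) (j : Fin 4) :
    MvPolynomial.aeval u (basisCubics a j) = cubicMap (algebraMap K L ∘ a) u j := by
  refine (map_cubicMap _ (MvPolynomial.aeval (R := K) u).toRingHom _ j).trans ?_
  congr 1 <;> ext <;> simp

theorem extendScalars_basisCubics (a : Fin 6 → K) :
    extendScalars L (basisCubics a) = basisCubics (algebraMap K L ∘ a) := by
  ext1 j
  refine (map_cubicMap _ (MvPolynomial.map (algebraMap K L)) _ j).trans ?_
  rw [basisCubics]
  congr 1 <;> ext1 <;> simp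

theorem mem_cubicsThrough {f : MvPolynomial (Fin 3) L} :
    f ∈ cubicsThrough θ ↔ f.IsHomogeneous 3 ∧
      ∀ i, MvPolynomial.aeval (R := L) (cuspPoint (θ i)) f = 0 := by
  simp [cubicsThrough]

theorem basisCubics_mem_cubicsThrough {e : Fin 6 → L} (h : GeneralSextic e θ) (k : Fin 4) :
    basisCubics e k ∈ cubicsThrough θ := by
  refine mem_cubicsThrough.mpr ⟨?_, fun i => ?_⟩
  · rw [← MvPolynomial.mem_homogeneousSubmodule, ← span_range_cubicMonomials, basisCubics_eq_sum]
    exact Submodule.sum_smul_mem _ _ fun i _ => Submodule.subset_span ⟨i, rfl⟩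
  · rw [aeval_basisCubics]
    exact congrFun (cubicMap_cuspPoint_eq_zero h i) k

/- Subtracting a combination of the `basisCubics` leaves a form in the first six monomials. Its
restriction to the cuspidal cubic has degree at most five, and six zeros. -/
theorem mem_span_basisCubics (h : GeneralSextic (algebraMap K L ∘ a) θ)
    {f : MvPolynomial (Fin 3) K} (hf : f.IsHomogeneous 3)
    (hzero : ∀ i, MvPolynomial.aeval (cuspPoint (θ i)) f = 0) :
    f ∈ Submodule.span K (Set.range (basisCubics a)) := by
  rw [← MvPolynomial.mem_homogeneousSubmodule, ← span_range_cubicMonomials,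
    Submodule.mem_span_range_iff_exists_fun] at hf
  obtain ⟨c, rfl⟩ := hf
  set N := (basisCoeffs a).submatrix id (Fin.natAdd (m := 4) 6)
  have hunit : IsUnit N.det := by
    rw [det_basisCoeffs_submatrix_natAdd]
    exact isUnit_one.neg
  let g : Fin 4 → K := (c ∘ Fin.natAdd (m := 4) 6) ᵥ* N⁻¹
  let d : Fin 10 → K := c - g ᵥ* basisCoeffs a
  have hlast (j : Fin 4) : d (Fin.natAdd 6 j) = 0 := by
    have hgN : g ᵥ* N = c ∘ Fin.natAdd 6 := by
      rw [Matrix.vecMul_vecMul, Matrix.nonsing_inv_mul _ hunit, Matrix.vecMul_one]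
    exact sub_eq_zero.mpr (congrFun hgN j).symm
  have hdiff : ∑ i, c i • cubicMonomials K i - ∑ k, g k • basisCubics a k =
      ∑ i, d (Fin.castAdd 4 i) • cubicMonomials K (Fin.castAdd 4 i) := by
    rw [sum_smul_basisCubics, ← Finset.sum_sub_distrib]
    simp only [← sub_smul]
    refine (Fin.sum_univ_add (a := 6) (b := 4) fun i => d i • cubicMonomials K i).trans ?_
    simp only [hlast, zero_smul, Finset.sum_const_zero, add_zero]
  have hfirst : (fun i : Fin 6 => algebraMap K L (d (Fin.castAdd 4 i))) = 0 := by
    refine Matrix.eq_zero_of_forall_index_sum_mul_pow_eq_zero h.injective fun j => ?_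
    have heval := congrArg (MvPolynomial.aeval (cuspPoint (θ j))) hdiff
    rw [map_sub, hzero, map_sum, map_sum] at heval
    simpa only [map_smul, aeval_basisCubics, cubicMap_cuspPoint_eq_zero h, Pi.zero_apply,
      smul_zero, Finset.sum_const_zero, sub_zero, aeval_cuspPoint_cubicMonomials,
      ← Algebra.smul_def] using heval.symm
  have hd (i : Fin 6) : d (Fin.castAdd 4 i) = 0 :=
    (map_eq_zero (algebraMap K L)).mp (congrFun hfirst i)
  simp only [hd, zero_smul, Finset.sum_const_zero, sub_eq_zero] at hdiff
  rw [hdiff]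
  exact Submodule.sum_smul_mem _ _ fun k _ => Submodule.subset_span ⟨k, rfl⟩

theorem isRationalBasis_basisCubics (h : GeneralSextic (algebraMap K L ∘ a) θ) :
    IsRationalBasis θ (basisCubics a) := by
  refine ⟨?_, le_antisymm ?_ fun f hf => ?_⟩ <;> rw [extendScalars_basisCubics]
  · exact linearIndependent_basisCubics _
  · rw [Submodule.span_le]
    rintro _ ⟨k, rfl⟩
    exact basisCubics_mem_cubicsThrough h k
  · obtain ⟨hf, hzero⟩ := mem_cubicsThrough.mp hf
    exact mem_span_basisCubics (K := L) h hf hzero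

theorem IsRationalBasis.linearIndependent_base {f : Fin 4 → MvPolynomial (Fin 3) K}
    (hf : IsRationalBasis θ f) : LinearIndependent K f :=
  LinearIndependent.of_comp (MvPolynomial.mapAlgHom (Algebra.ofId K L)).toLinearMap
    (hf.linearIndependent.restrict_scalars' K)

theorem IsRationalBasis.exists_matrix (h : GeneralSextic (algebraMap K L ∘ a) θ)
    {f : Fin 4 → MvPolynomial (Fin 3) K} (hf : IsRationalBasis θ f) :
    ∃ G H : Matrix (Fin 4) (Fin 4) K, G * H = 1 ∧
      ∀ u : Fin 3 → L, (fun j => MvPolynomial.eval u (extendScalars L f j)) =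
        G.map (algebraMap K L) *ᵥ cubicMap (algebraMap K L ∘ a) u := by
  have hmem (j : Fin 4) : ∃ g : Fin 4 → K, ∑ k, g k • basisCubics a k = f j := by
    have hj : extendScalars L f j ∈ cubicsThrough θ :=
      hf.span_eq ▸ Submodule.subset_span ⟨j, rfl⟩
    obtain ⟨hhom, hzero⟩ := mem_cubicsThrough.mp hj
    rw [← Submodule.mem_span_range_iff_exists_fun]
    refine mem_span_basisCubics h (hhom.of_map (algebraMap K L).injective) fun i => ?_
    simpa only [extendScalars, MvPolynomial.aeval_map_algebraMap] using hzero i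
  choose G hG using hmem
  have hdet : (Matrix.of G).det ≠ 0 := fun hdet => by
    obtain ⟨x, hx, hxG⟩ := Matrix.exists_vecMul_eq_zero_iff.mpr hdet
    have hsum : ∑ j, x j • f j = ∑ k, (x ᵥ* Matrix.of G) k • basisCubics a k := by
      simp only [← hG, Finset.smul_sum, smul_smul, Matrix.vecMul, dotProduct, Finset.sum_smul]
      exact Finset.sum_comm
    simp only [hxG, Pi.zero_apply, zero_smul, Finset.sum_const_zero] at hsum
    exact hx (funext (Fintype.linearIndependent_iff.mp hf.linearIndependent_base x hsum))
  refine ⟨Matrix.of G, (Matrix.of G)⁻¹, Matrix.mul_nonsing_inv _ hdet.isUnit, fun u => ?_⟩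
  ext j
  rw [extendScalars, ← hG, MvPolynomial.eval_map, ← MvPolynomial.aeval_def, map_sum,
    Matrix.mulVec_eq_sum, Finset.sum_apply]
  refine Finset.sum_congr rfl fun k _ => ?_
  simp [aeval_basisCubics, Algebra.smul_def, mul_comm]

end RationalBasis

section RationalLines

variable {K L : Type*} [Field K] [Field L] [Algebra K L]

theorem IsRationalSubspace.map {m n : Type*} [Fintype m] {W : Submodule L (m → L)}
    (hW : IsRationalSubspace K W) (M : Matrix n m K) :
    IsRationalSubspace K (W.map (M.map (algebraMap K L)).mulVecLin) := by
  obtain ⟨W₀, rfl⟩ := hW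
  refine ⟨W₀.map M.mulVecLin, ?_⟩
  rw [Submodule.map_span, Submodule.map_coe, Set.image_image, Set.image_image]
  congr 2
  ext w j
  simp [Matrix.mulVec, dotProduct]

theorem isRationalSubspace_map_iff {n : Type*} [Fintype n] [DecidableEq n] {G H : Matrix n n K}
    (hGH : G.map (algebraMap K L) * H.map (algebraMap K L) = 1) {W : Submodule L (n → L)} :
    IsRationalSubspace K (W.map (H.map (algebraMap K L)).mulVecLin) ↔ IsRationalSubspace K W := by
  refine ⟨fun hW => ?_, fun hW => hW.map H⟩
  have hGW := hW.map G
  rwa [← Submodule.map_comp, ← Matrix.mulVecLin_mul, hGH, Matrix.mulVecLin_one,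
    Submodule.map_id] at hGW

/-- The sets of `d` indices that are unions of Galois orbits. -/
def stableSets {ι : Type*} (K : Type*) {L : Type*} [Field K] [Field L] [Algebra K L] (θ : ι → L)
    (d : ℕ) : Set (Set ι) :=
  {I | I.ncard = d ∧ IsGaloisStable K θ I}

variable [IsAlgClosed L] {a : Fin 6 → K} {θ : Fin 6 → L}

theorem encard_rational_isSurfaceLine [IsGalois K L] (h : GeneralSextic (algebraMap K L ∘ a) θ) :
    {W | IsSurfaceLine (algebraMap K L ∘ a) W ∧ IsRationalSubspace K W}.encard =
      (stableSets K θ 1 ∪ (stableSets K θ 2 ∪ stableSets K θ 5)).encard := by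
  have hinj : Set.InjOn (incidence (algebraMap K L ∘ a) θ)
      {W | IsSurfaceLine (algebraMap K L ∘ a) W ∧ IsRationalSubspace K W} :=
    (incidence_injOn h).mono fun _ hW => hW.1
  rw [← hinj.encard_image]
  congr 1
  ext I
  constructor
  · rintro ⟨W, ⟨hW, hrat⟩, rfl⟩
    have hstable := (isRationalSubspace_iff_isGaloisStable h hW).mp hrat
    exact (hW.incidence_trichotomy h).imp (⟨·.1, hstable⟩)
      (Or.imp (⟨·.1, hstable⟩) (⟨·.1, hstable⟩))
  · intro hI
    have hcard : I.ncard = 1 ∨ I.ncard = 2 ∨ I.ncard = 5 :=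
      hI.imp And.left (Or.imp And.left And.left)
    have hstable : IsGaloisStable K θ I := hI.elim And.right (Or.elim · And.right And.right)
    obtain ⟨W, hW, rfl⟩ := exists_incidence_eq h hcard
    exact ⟨W, ⟨hW, (isRationalSubspace_iff_isGaloisStable h hW).mpr hstable⟩, rfl⟩

variable {G H : Matrix (Fin 4) (Fin 4) K} {f : Fin 4 → MvPolynomial (Fin 3) L}

theorem mem_rationalLines_blowUpSurface_iff (h : GeneralSextic (algebraMap K L ∘ a) θ)
    (hGH : G.map (algebraMap K L) * H.map (algebraMap K L) = 1)
    (hf : ∀ u, (fun j => MvPolynomial.eval u (f j)) =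
      G.map (algebraMap K L) *ᵥ cubicMap (algebraMap K L ∘ a) u)
    {W : Submodule L (Fin 4 → L)} :
    W ∈ rationalLines K (blowUpSurface f) ↔
      IsSurfaceLine (algebraMap K L ∘ a) (W.map (H.map (algebraMap K L)).mulVecLin) ∧
        IsRationalSubspace K (W.map (H.map (algebraMap K L)).mulVecLin) := by
  have hinj : Function.Injective (H.map (algebraMap K L)).mulVecLin :=
    Matrix.mulVec_injective_of_isUnit (.of_mul_eq_one_right _ hGH)
  have hfinrank : Module.finrank L (W.map (H.map (algebraMap K L)).mulVecLin) =
      Module.finrank L W :=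
    (Submodule.equivMapOfInjective _ hinj W).finrank_eq.symm
  have hsurface : (∀ (v : Fin 4 → L) (hv : v ≠ 0), v ∈ W →
      Projectivization.mk L v hv ∈ blowUpSurface f) ↔
        ∀ v ∈ W.map (H.map (algebraMap K L)).mulVecLin,
          (syzMatrix (algebraMap K L ∘ a) v).det = 0 := by
    constructor
    · rintro hW _ ⟨v, hv, rfl⟩
      by_cases hv0 : v = 0
      · rw [hv0, map_zero, map_zero, Matrix.det_zero]
      · exact (mk_mem_blowUpSurface_iff h hGH hf).mp (hW v hv0 hv)
    · exact fun hW v _ hv => (mk_mem_blowUpSurface_iff h hGH hf).mpr (hW _ ⟨v, hv, rfl⟩)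
  rw [IsSurfaceLine, hfinrank, ← hsurface, isRationalSubspace_map_iff hGH, and_assoc]
  rfl

theorem encard_rationalLines_blowUpSurface [IsGalois K L]
    (h : GeneralSextic (algebraMap K L ∘ a) θ)
    (hGH : G.map (algebraMap K L) * H.map (algebraMap K L) = 1)
    (hf : ∀ u, (fun j => MvPolynomial.eval u (f j)) =
      G.map (algebraMap K L) *ᵥ cubicMap (algebraMap K L ∘ a) u) :
    (rationalLines K (blowUpSurface f)).encard =
      (stableSets K θ 1 ∪ (stableSets K θ 2 ∪ stableSets K θ 5)).encard := by
  let q := Matrix.toLin'OfInv hGH (mul_eq_one_comm.mp hGH)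
  refine Eq.trans ?_ (encard_rational_isSurfaceLine h)
  rw [← Set.encard_preimage_of_bijective (Submodule.orderIsoMapComap q).bijective
    {W | IsSurfaceLine (algebraMap K L ∘ a) W ∧ IsRationalSubspace K W}]
  congr 1
  ext W
  exact mem_rationalLines_blowUpSurface_iff h hGH hf

end RationalLines

section Counting

variable {ι K L : Type*} [Field K] [Field L] [Algebra K L] {θ : ι → L} {I : Set ι}

theorem IsGaloisStable.compl (hI : IsGaloisStable K θ I) : IsGaloisStable K θ Iᶜ :=
  fun σ i j hij hi hj => hi (hI σ.symm j i (by rw [← hij, σ.symm_apply_apply]) hj)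

theorem disjoint_stableSets {m n : ℕ} (hmn : m ≠ n) :
    Disjoint (stableSets K θ m) (stableSets K θ n) :=
  Set.disjoint_left.mpr fun _ hm hn => hmn (hm.1.symm.trans hn.1)

theorem ncard_stableSets_eq_of_add_eq_card [Finite ι] {m n : ℕ} (hmn : m + n = Nat.card ι) :
    (stableSets K θ m).ncard = (stableSets K θ n).ncard := by
  have hcompl : ∀ {m n : ℕ}, m + n = Nat.card ι →
      ∀ I ∈ stableSets K θ m, Iᶜ ∈ stableSets K θ n := by
    rintro m n hmn I ⟨hI, hstable⟩
    have hcard := Set.ncard_add_ncard_compl I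
    exact ⟨by lia, hstable.compl⟩
  rw [← Set.ncard_image_of_injective _ compl_injective]
  congr 1
  refine Set.Subset.antisymm (Set.image_subset_iff.mpr (hcompl hmn)) fun I hI => ?_
  exact ⟨Iᶜ, hcompl (add_comm m n ▸ hmn) I hI, compl_compl I⟩

/-- The indices of the roots of `Q` among the `θ i`. -/
def rootIndices (θ : ι → L) (Q : K[X]) : Set ι := {i | aeval (θ i) Q = 0}

theorem isGaloisStable_rootIndices (Q : K[X]) : IsGaloisStable K θ (rootIndices θ Q) := by
  intro σ i j hij (hi : aeval (θ i) Q = 0)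
  rw [rootIndices, Set.mem_ofPred_eq, ← hij, aeval_algEquiv, AlgHom.comp_apply, hi, map_zero]

theorem mem_rootIndices_minpoly (i : ι) : i ∈ rootIndices θ (minpoly K (θ i)) :=
  minpoly.aeval K (θ i)

theorem IsGaloisStable.rootIndices_minpoly_subset [Normal K L] (hI : IsGaloisStable K θ I) {i : ι}
    (hi : i ∈ I) : rootIndices θ (minpoly K (θ i)) ⊆ I := by
  intro j hj
  have hint : IsIntegral K (θ i) := Algebra.IsIntegral.isIntegral _
  have hminpoly : minpoly K (θ j) = minpoly K (θ i) :=
    (minpoly.eq_of_irreducible_of_monic (minpoly.irreducible hint) hj (minpoly.monic hint)).symm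
  obtain ⟨σ, hσ⟩ := (Normal.minpoly_eq_iff_mem_orbit L).mp hminpoly
  exact hI σ i j hσ hi

/-- The monic irreducible factors of `F` of degree `d`. -/
def monicFactors (F : K[X]) (d : ℕ) : Set K[X] :=
  {Q | Irreducible Q ∧ Q.Monic ∧ Q ∣ F ∧ Q.natDegree = d}

variable {F : K[X]}

theorem ncard_monicFactors (hF : Squarefree F) (d : ℕ) :
    (monicFactors F d).ncard = numIrreducibleFactors F d := by
  classical
  have hnodup : (UniqueFactorizationMonoid.normalizedFactors F).Nodup :=
    (UniqueFactorizationMonoid.squarefree_iff_nodup_normalizedFactors hF.ne_zero).mp hF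
  have hfactors : monicFactors F d =
      (((UniqueFactorizationMonoid.normalizedFactors F).filter
        fun P => P.natDegree = d).toFinset : Set K[X]) := by
    ext Q
    rw [Finset.mem_coe, Multiset.mem_toFinset, Multiset.mem_filter,
      Polynomial.mem_normalizedFactors_iff hF.ne_zero, and_assoc, and_assoc]
    rfl
  rw [hfactors, Set.ncard_coe_finset, Multiset.toFinset_card_of_nodup (hnodup.filter _),
    numIrreducibleFactors]

theorem eq_minpoly_of_mem_rootIndices {d : ℕ} {Q : K[X]} (hQ : Q ∈ monicFactors F d) {i : ι}
    (hi : i ∈ rootIndices θ Q) : Q = minpoly K (θ i) :=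
  minpoly.eq_of_irreducible_of_monic hQ.1 hi hQ.2.1

theorem minpoly_mem_monicFactors [Algebra.IsAlgebraic K L] (hF : F.rootSet L = Set.range θ)
    (i : ι) : minpoly K (θ i) ∈ monicFactors F (minpoly K (θ i)).natDegree := by
  have hint : IsIntegral K (θ i) := Algebra.IsIntegral.isIntegral _
  have hroot : θ i ∈ F.rootSet L := hF ▸ Set.mem_range_self i
  exact ⟨minpoly.irreducible hint, minpoly.monic hint,
    minpoly.dvd K _ (aeval_eq_zero_of_mem_rootSet hroot), rfl⟩

/-- The indices `i` whose Galois orbit is `{i}`: if the `θ i` are all the roots of a separable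
polynomial over `K`, those with `θ i` in `K`. -/
def rationalIndices (K : Type*) {L : Type*} [Field K] [Field L] [Algebra K L] (θ : ι → L) :
    Set ι :=
  {i | IsGaloisStable K θ {i}}

theorem isGaloisStable_of_subset_rationalIndices (hI : I ⊆ rationalIndices K θ) :
    IsGaloisStable K θ I := by
  intro σ i j hij hi
  rwa [show j = i from hI hi σ i j hij rfl]

theorem ncard_rationalIndices : (rationalIndices K θ).ncard = (stableSets K θ 1).ncard := by
  rw [← Set.ncard_image_of_injective _ Set.singleton_injective]
  congr 1
  ext I
  constructor
  · rintro ⟨i, hi, rfl⟩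
    exact ⟨Set.ncard_singleton i, hi⟩
  · rintro ⟨hI, hstable⟩
    obtain ⟨i, rfl⟩ := Set.ncard_eq_one.mp hI
    exact ⟨i, hstable, rfl⟩

theorem disjoint_image_rootIndices [Finite ι] [Normal K L] :
    Disjoint (rootIndices θ '' monicFactors F 2)
      {I | I ⊆ rationalIndices K θ ∧ I.ncard = 2} := by
  rw [Set.disjoint_left]
  rintro _ ⟨Q, hQ, rfl⟩ ⟨hrational, hcard⟩
  obtain ⟨i, hi⟩ : (rootIndices θ Q).Nonempty := Set.nonempty_of_ncard_ne_zero (by lia)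
  have hsub := IsGaloisStable.rootIndices_minpoly_subset (hrational hi) (Set.mem_singleton i)
  rw [← eq_minpoly_of_mem_rootIndices hQ hi] at hsub
  have hle := Set.ncard_le_ncard hsub
  rw [hcard, Set.ncard_singleton] at hle
  lia

variable [IsAlgClosed L]

theorem ncard_rootIndices (hinj : Function.Injective θ) (hF : F.rootSet L = Set.range θ)
    (hsep : F.Separable) {d : ℕ} {Q : K[X]} (hQ : Q ∈ monicFactors F d) :
    (rootIndices θ Q).ncard = d := by
  obtain ⟨hirr, -, hdvd, hdeg⟩ := hQ
  have hsub : Q.rootSet L ⊆ Set.range θ := fun t ht => hF ▸ mem_rootSet.mpr ⟨hsep.ne_zero,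
    aeval_eq_zero_of_dvd_aeval_eq_zero hdvd (aeval_eq_zero_of_mem_rootSet ht)⟩
  have himage : θ '' rootIndices θ Q = Q.rootSet L := by
    rw [← Set.inter_eq_self_of_subset_left hsub, ← Set.image_preimage_eq_inter_range]
    congr 1
    ext i
    exact (mem_rootSet_of_ne hirr.ne_zero).symm
  rw [← Set.ncard_image_of_injective _ hinj, himage, ← hdeg,
    ← card_rootSet_eq_natDegree (hsep.of_dvd hdvd) (IsAlgClosed.splits (Q.map (algebraMap K L))),
    ← Nat.card_eq_fintype_card, Nat.card_coe_set_eq]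

theorem injOn_rootIndices (hinj : Function.Injective θ) (hF : F.rootSet L = Set.range θ)
    (hsep : F.Separable) (d : ℕ) : Set.InjOn (rootIndices θ) (monicFactors F d) := by
  intro Q hQ Q' hQ' heq
  obtain ⟨i, hi⟩ : (rootIndices θ Q).Nonempty := by
    refine Set.nonempty_of_ncard_ne_zero ?_
    rw [ncard_rootIndices hinj hF hsep hQ, ← hQ.2.2.2]
    exact hQ.1.natDegree_pos.ne'
  rw [eq_minpoly_of_mem_rootIndices hQ hi, eq_minpoly_of_mem_rootIndices hQ' (heq ▸ hi)]

theorem rootIndices_mem_stableSets (hinj : Function.Injective θ)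
    (hF : F.rootSet L = Set.range θ) (hsep : F.Separable) {d : ℕ} {Q : K[X]}
    (hQ : Q ∈ monicFactors F d) : rootIndices θ Q ∈ stableSets K θ d :=
  ⟨ncard_rootIndices hinj hF hsep hQ, isGaloisStable_rootIndices Q⟩

variable [Normal K L]

theorem mem_image_rootIndices_of_subset (hinj : Function.Injective θ)
    (hF : F.rootSet L = Set.range θ) (hsep : F.Separable) (hI : IsGaloisStable K θ I) {i : ι}
    (hi : i ∈ I) (hsub : I ⊆ rootIndices θ (minpoly K (θ i))) :
    I ∈ rootIndices θ '' monicFactors F I.ncard := by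
  obtain rfl := hsub.antisymm (hI.rootIndices_minpoly_subset hi)
  have hmem := minpoly_mem_monicFactors hF i
  exact ⟨_, (ncard_rootIndices hinj hF hsep hmem).symm ▸ hmem, rfl⟩

theorem stableSets_one (hinj : Function.Injective θ) (hF : F.rootSet L = Set.range θ)
    (hsep : F.Separable) : stableSets K θ 1 = rootIndices θ '' monicFactors F 1 := by
  refine Set.Subset.antisymm ?_
    (Set.image_subset_iff.mpr fun Q => rootIndices_mem_stableSets hinj hF hsep)
  rintro I ⟨hI, hstable⟩
  obtain ⟨i, rfl⟩ := Set.ncard_eq_one.mp hI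
  exact hI ▸ mem_image_rootIndices_of_subset hinj hF hsep hstable rfl
    (Set.singleton_subset_iff.mpr (mem_rootIndices_minpoly i))

theorem stableSets_two [Finite ι] (hinj : Function.Injective θ) (hF : F.rootSet L = Set.range θ)
    (hsep : F.Separable) :
    stableSets K θ 2 =
      rootIndices θ '' monicFactors F 2 ∪ {I | I ⊆ rationalIndices K θ ∧ I.ncard = 2} := by
  refine Set.Subset.antisymm ?_ (Set.union_subset
    (Set.image_subset_iff.mpr fun Q => rootIndices_mem_stableSets hinj hF hsep)
    fun I hI => ⟨hI.2, isGaloisStable_of_subset_rationalIndices hI.1⟩)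
  rintro I ⟨hI, hstable⟩
  by_cases hrational : I ⊆ rationalIndices K θ
  · exact .inr ⟨hrational, hI⟩
  obtain ⟨i, hi, hi_irrational⟩ := Set.not_subset.mp hrational
  have hnontrivial : (rootIndices θ (minpoly K (θ i))).Nontrivial := by
    refine (Set.nontrivial_iff_ne_singleton (mem_rootIndices_minpoly i)).mpr fun heq => ?_
    have hstable_i := isGaloisStable_rootIndices (θ := θ) (minpoly K (θ i))
    rw [heq] at hstable_i
    exact hi_irrational hstable_i
  have heq : rootIndices θ (minpoly K (θ i)) = I :=
    Set.eq_of_subset_of_ncard_le (hstable.rootIndices_minpoly_subset hi)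
      (hI.trans_le (Set.one_lt_ncard_iff_nontrivial.mpr hnontrivial))
  exact .inl (hI ▸ mem_image_rootIndices_of_subset hinj hF hsep hstable hi heq.ge)

theorem ncard_stableSets_one (hinj : Function.Injective θ) (hF : F.rootSet L = Set.range θ)
    (hsep : F.Separable) : (stableSets K θ 1).ncard = numIrreducibleFactors F 1 := by
  rw [stableSets_one hinj hF hsep, (injOn_rootIndices hinj hF hsep 1).ncard_image,
    ncard_monicFactors hsep.squarefree]

theorem ncard_stableSets_two [Finite ι] (hinj : Function.Injective θ)
    (hF : F.rootSet L = Set.range θ) (hsep : F.Separable) :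
    (stableSets K θ 2).ncard =
      numIrreducibleFactors F 2 + (numIrreducibleFactors F 1).choose 2 := by
  rw [stableSets_two hinj hF hsep, Set.ncard_union_eq disjoint_image_rootIndices,
    (injOn_rootIndices hinj hF hsep 2).ncard_image, ncard_monicFactors hsep.squarefree,
    Set.ncard_powerset_ncard (Set.toFinite _), ncard_rationalIndices,
    ncard_stableSets_one hinj hF hsep]

theorem ncard_stableSets_one_union_two_union_five {θ : Fin 6 → L} (hinj : Function.Injective θ)
    (hF : F.rootSet L = Set.range θ) (hsep : F.Separable) :
    (stableSets K θ 1 ∪ (stableSets K θ 2 ∪ stableSets K θ 5)).ncard =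
      2 * numIrreducibleFactors F 1 + numIrreducibleFactors F 2 +
        (numIrreducibleFactors F 1).choose 2 := by
  have hfive : (stableSets K θ 5).ncard = (stableSets K θ 1).ncard :=
    ncard_stableSets_eq_of_add_eq_card (by rw [Nat.card_fin])
  rw [Set.ncard_union_eq (Set.disjoint_union_right.mpr
      ⟨disjoint_stableSets (by decide), disjoint_stableSets (by decide)⟩),
    Set.ncard_union_eq (disjoint_stableSets (by decide)), hfive,
    ncard_stableSets_one hinj hF hsep, ncard_stableSets_two hinj hF hsep]
  ring

end Counting

section Main

variable {K L : Type*} [Field K] [Field L] [Algebra K L]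

theorem AvoidsE6.injective {θ : Fin 6 → L} (h : AvoidsE6 θ) : Function.Injective θ :=
  .of_lt_imp_ne fun i j hij => _root_.sub_ne_zero.mp (h.sub_ne_zero i j hij)

theorem AvoidsE6.add_add_ne_zero_of_ne {θ : Fin 6 → L} (h : AvoidsE6 θ) (i j k : Fin 6)
    (hij : i ≠ j) (hjk : j ≠ k) (hik : i ≠ k) : θ i + θ j + θ k ≠ 0 := by
  grind [h.add_add_ne_zero]

section Roots

variable {ι : Type*} [Fintype ι] {θ : ι → L} {F : K[X]} {c : L}

theorem rootSet_eq_range (hc : c ≠ 0) (hθ : F.map (algebraMap K L) = C c * ∏ i, (X - C (θ i))) :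
    F.rootSet L = Set.range θ := by
  have hF : F ≠ 0 := by
    rintro rfl
    have hprod := (monic_prod_X_sub_C θ Finset.univ).ne_zero
    exact mul_ne_zero (C_ne_zero.mpr hc) hprod (by rw [← hθ, Polynomial.map_zero])
  ext t
  rw [mem_rootSet_of_ne hF, ← eval_map_algebraMap, hθ, eval_mul, eval_C, eval_prod,
    mul_eq_zero_iff_left hc, Finset.prod_eq_zero_iff]
  simp [sub_eq_zero, eq_comm]

theorem separable_of_map_eq_prod (hc : c ≠ 0) (hinj : Function.Injective θ)
    (hθ : F.map (algebraMap K L) = C c * ∏ i, (X - C (θ i))) : F.Separable := by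
  rw [← separable_map (algebraMap K L), hθ]
  exact (separable_prod_X_sub_C_iff.mpr hinj).unit_mul (isUnit_C.mpr hc.isUnit)

end Roots

variable {θ : Fin 6 → L} {F : K[X]}

/-- The signed coefficients of the monic multiple of a sextic, so that the first one is the sum
of its roots. -/
noncomputable def signedCoeffs (F : K[X]) : Fin 6 → K :=
  F.leadingCoeff⁻¹ •
    ![-F.coeff 5, F.coeff 4, -F.coeff 3, F.coeff 2, -F.coeff 1, F.coeff 0]

theorem algebraMap_leadingCoeff_ne_zero (hF : F.natDegree ≠ 0) :
    algebraMap K L F.leadingCoeff ≠ 0 := by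
  simpa using ne_zero_of_natDegree_gt (Nat.pos_of_ne_zero hF)

theorem eq_sum_coeff_of_natDegree_eq_six (hdeg : F.natDegree = 6) :
    F = C F.leadingCoeff * X ^ 6 + C (F.coeff 5) * X ^ 5 + C (F.coeff 4) * X ^ 4
      + C (F.coeff 3) * X ^ 3 + C (F.coeff 2) * X ^ 2 + C (F.coeff 1) * X + C (F.coeff 0) := by
  conv_lhs => rw [F.as_sum_range_C_mul_X_pow, hdeg]
  rw [leadingCoeff, hdeg]
  simp only [Finset.sum_range_succ, Finset.sum_range_zero]
  ring

theorem leadingCoeff_mul_sextic_signedCoeffs (hdeg : F.natDegree = 6) (t : L) :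
    algebraMap K L F.leadingCoeff * sextic (algebraMap K L ∘ signedCoeffs F) t = aeval t F := by
  have hlc : algebraMap K L F.leadingCoeff ≠ 0 := algebraMap_leadingCoeff_ne_zero (by lia)
  conv_rhs => rw [eq_sum_coeff_of_natDegree_eq_six hdeg]
  simp [sextic, signedCoeffs]
  field

theorem leadingCoeff_mul_sexticDeriv_signedCoeffs (hdeg : F.natDegree = 6) (t : L) :
    algebraMap K L F.leadingCoeff * sexticDeriv (algebraMap K L ∘ signedCoeffs F) t =
      aeval t (derivative F) := by
  have hlc : algebraMap K L F.leadingCoeff ≠ 0 := algebraMap_leadingCoeff_ne_zero (by lia)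
  conv_rhs => rw [eq_sum_coeff_of_natDegree_eq_six hdeg]
  simp [sexticDeriv, signedCoeffs, map_ofNat (algebraMap K L)]
  field

theorem signedCoeffs_zero (hdeg : F.natDegree = 6)
    (hθ : F.map (algebraMap K L) =
      C (algebraMap K L F.leadingCoeff) * ∏ i, (X - C (θ i))) :
    algebraMap K L (signedCoeffs F 0) = ∑ i, θ i := by
  have hlc : algebraMap K L F.leadingCoeff ≠ 0 := algebraMap_leadingCoeff_ne_zero (by lia)
  have hfive : algebraMap K L (F.coeff 5) = algebraMap K L F.leadingCoeff * -∑ i, θ i := by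
    have hcoeff := prod_X_sub_C_coeff_card_pred (Finset.univ : Finset (Fin 6)) θ (by simp)
    rw [Finset.card_univ, Fintype.card_fin] at hcoeff
    rw [← coeff_map, hθ, coeff_C_mul, hcoeff]
  simp [signedCoeffs, hfive, hlc]

theorem generalSextic_signedCoeffs (hdeg : F.natDegree = 6)
    (hθ : F.map (algebraMap K L) =
      C (algebraMap K L F.leadingCoeff) * ∏ i, (X - C (θ i))) (hE6 : AvoidsE6 θ) :
    GeneralSextic (algebraMap K L ∘ signedCoeffs F) θ := by
  have hlc : algebraMap K L F.leadingCoeff ≠ 0 := algebraMap_leadingCoeff_ne_zero (by lia)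
  have hroots (t : L) : aeval t F = 0 ↔ ∃ i, θ i = t := by
    rw [← mem_rootSet_of_ne (ne_zero_of_natDegree_gt (n := 0) (by lia)),
      rootSet_eq_range hlc hθ, Set.mem_range]
  refine ⟨hE6.injective, fun t => ?_, fun i => ?_, hE6.add_add_ne_zero_of_ne, ?_⟩
  · rw [← hroots, ← leadingCoeff_mul_sextic_signedCoeffs hdeg, mul_eq_zero_iff_left hlc]
  · refine right_ne_zero_of_mul (a := algebraMap K L F.leadingCoeff) ?_
    rw [leadingCoeff_mul_sexticDeriv_signedCoeffs hdeg]
    exact (separable_of_map_eq_prod hlc hE6.injective hθ).aeval_derivative_ne_zero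
      ((hroots _).mpr ⟨i, rfl⟩)
  · exact (signedCoeffs_zero hdeg hθ).trans_ne hE6.sum_ne_zero

end Main

theorem lemma2_general {K L : Type*} [Field K] [Field L] [Algebra K L] [IsAlgClosed L]
    [IsGalois K L] (F : K[X]) (hdeg : F.natDegree = 6) (θ : Fin 6 → L)
    (hθ : F.map (algebraMap K L) =
      C (algebraMap K L F.leadingCoeff) * ∏ i, (X - C (θ i)))
    (hE6 : AvoidsE6 θ) :
    (∃ f : Fin 4 → MvPolynomial (Fin 3) K, IsRationalBasis θ f) ∧
    ∀ f : Fin 4 → MvPolynomial (Fin 3) K, IsRationalBasis θ f →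
      Set.InjOn Prod.snd (blowUp (extendScalars L f)) ∧
      IsSmoothCubicSurfaceOver K (blowUpSurface (extendScalars L f)) ∧
      (rationalLines K (blowUpSurface (extendScalars L f))).encard =
        ((2 * numIrreducibleFactors F 1 + numIrreducibleFactors F 2 +
          (numIrreducibleFactors F 1).choose 2 : ℕ) : ℕ∞) := by
  have h := generalSextic_signedCoeffs hdeg hθ hE6
  have hlc : algebraMap K L F.leadingCoeff ≠ 0 := algebraMap_leadingCoeff_ne_zero (by lia)
  refine ⟨⟨_, isRationalBasis_basisCubics h⟩, fun f hf => ?_⟩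
  obtain ⟨G, H, hGH, hfG⟩ := hf.exists_matrix h
  have hGHL : G.map (algebraMap K L) * H.map (algebraMap K L) = 1 := by
    rw [← Matrix.map_mul, hGH, Matrix.map_one _ (map_zero _) (map_one _)]
  refine ⟨injOn_snd_blowUp h hGHL hfG, isSmoothCubicSurfaceOver_blowUpSurface h hGHL hfG, ?_⟩
  rw [encard_rationalLines_blowUpSurface h hGHL hfG, ← (Set.toFinite _).cast_ncard_eq,
    ncard_stableSets_one_union_two_union_five hE6.injective (rootSet_eq_range hlc hθ)
      (separable_of_map_eq_prod hlc hE6.injective hθ)]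

theorem lemma2 (p : ℕ) [Fact p.Prime] (F : ℚ_[p][X]) (hdeg : F.natDegree = 6)
    (θ : Fin 6 → AlgebraicClosure ℚ_[p])
    (hθ : F.map (algebraMap ℚ_[p] (AlgebraicClosure ℚ_[p])) =
      C (algebraMap ℚ_[p] (AlgebraicClosure ℚ_[p]) F.leadingCoeff) * ∏ i, (X - C (θ i)))
    (hE6 : AvoidsE6 θ) :
    (∃ f : Fin 4 → MvPolynomial (Fin 3) ℚ_[p], IsRationalBasis θ f) ∧
    ∀ f : Fin 4 → MvPolynomial (Fin 3) ℚ_[p], IsRationalBasis θ f →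
      Set.InjOn Prod.snd (blowUp (extendScalars (AlgebraicClosure ℚ_[p]) f)) ∧
      IsSmoothCubicSurfaceOver ℚ_[p]
        (blowUpSurface (extendScalars (AlgebraicClosure ℚ_[p]) f)) ∧
      (rationalLines ℚ_[p] (blowUpSurface (extendScalars (AlgebraicClosure ℚ_[p]) f))).encard =
        ((2 * numIrreducibleFactors F 1 + numIrreducibleFactors F 2 +
          (numIrreducibleFactors F 1).choose 2 : ℕ) : ℕ∞) :=
  lemma2_general F hdeg θ hθ hE6
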